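/- Let $K$ be a commutative semiring with $0\neq 1$. **Matrix side.** A matrix schema $\mathcal S$ is a finite set of size symbols, containing a special symbol $1$, and of matrix symbols $\mathbf A$, each with a type $(\alpha,\beta)$ of size symbols of $\mathcal S$. An instance $\mathcal I$ assigns to each size symbol $\alpha$ a positive integer $\alpha^{\mathcal I}$ with $1^{\mathcal I}=1$, and to each $\mathbf A:(\alpha,\beta)$ an $\alpha^{\mathcal I}\times\beta^{\mathcal I}$ matrix over $K$. Well-typed expressions are evaluated as usual ($\mathbf 1^\alpha$ is the ones column vector of type $(\alpha,1)$, $\mathbf I^\alpha$ the identity matrix, $e_1\times e_2$ scalar multiplication with $e_1:(1,1)$, $\odot$ the entrywise product). *simple-MATLANG* is the language $$e ::= \mathbf A \mid \mathbf 1^\alpha \mid \mathbf I^\alpha \mid e^T \mid e_1\times e_2 \mid e_1\odot e_2\mid e\cdot \mathbf 1^\alpha ,$$ and *qh-MATLANG* is the language $$e ::= e_1 \mid e_1\odot(e_2\cdot(\mathbf 1^\beta)^T)\mid(\mathbf 1^\alpha\cdot e_1)\odot e_2\mid(\mathbf 1^\alpha\cdot e_1)\odot(e_2\cdot(\mathbf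 1^\beta)^T)$$ with $e_1,e_2$ in simple-MATLANG. A qh-MATLANG query over $\mathcal S$ is $\mathbf H:=e$ with $e$ a well-typed qh-MATLANG expression over $\mathcal S$ and $\mathbf H\notin\mathcal S$ a new matrix symbol of the same type as $e$. **Relational side.** A vocabulary $\sigma$ is a finite set of relation symbols with arities and of constant symbols, containing a constant $1$. A database $db$ assigns to each constant a positive integer, with $1^{db}=1$, and to each $k$-ary relation symbol a finitely supported function $\mathbb N_{>0}^k\to K$. A conjunctive query (CQ) is $Q: H(\bar x)\gets\exists\bar y.\,a_1\wedge\dots\wedge a_n$ ($n\ge1$), where each $a_i$ is a relational atom $R(\bar z)$ or a comparison atom $x\le c$, the sequence $\bar x$ (possibly with repetitions) lists exactly the free variables of the body, and $H\notin\sigma$. Its semantics is the semiring semantics: $\wedge$ is multiplication in $K$, $\exists y$ is summation over the values of $y$ (and has no effect if $y$ is not free in its scope), $x\le c$ has value $1$ or $0$, and the output is $0$ on tuples that do not match the repetitions in $\bar x$. $Q$ is *binary* if all its relational atoms, including the head, have arity at most $2$. For a variable $x$ let $\mathrm{atoms}(x)$ be the set of relational atoms of the body that mention $x$. $Q$ is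 *q-hierarchical* if for any two variables $x,y$ that occur in relational atoms of the body: (i) $\mathrm{atoms}(x)\subseteq\mathrm{atoms}(y)$ or $\mathrm{atoms}(y)\subseteq\mathrm{atoms}(x)$ or $\mathrm{atoms}(x)\cap\mathrm{atoms}(y)=\emptyset$; and (ii) if $x\in\bar x$ and $\mathrm{atoms}(x)\subsetneq\mathrm{atoms}(y)$, then $y\in\bar x$. **Encodings.** An $m\times n$ matrix $\mathbf A$ is encoded by a $K$-relation $R$ of arity $2$ if $R(i,j)=\mathbf A_{ij}$ for $i\le m$, $j\le n$ and $R$ is $0$ elsewhere; of arity $1$ if $n=1$ and $R(i)=\mathbf A_{i1}$ for $i\le m$ and $R$ is $0$ elsewhere, or symmetrically if $m=1$; of arity $0$ if $m=n=1$ and $R()=\mathbf A_{11}$. A schema encoding between $\mathcal S$ and $\sigma$ is a bijection that matches size symbols with constants, with $1\leftrightarrow1$, and matrix symbols with relation symbols of arity at most $2$, where arity $1$ requires a type of the form $(\alpha,1)$ or $(1,\alpha)$ and arity $0$ requires type $(1,1)$. An instance and a database encode each other if corresponding size symbols and constants have equal values and each matrix is encoded by the corresponding relation. For a schema encoding between $\mathcal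 S\cup\{\mathbf H\}$ and $\sigma\cup\{H\}$ matching $\mathbf H$ with $H$, the queries $\mathbf H:=e$ and $Q$ *simulate* each other if, whenever $\mathcal I$ and $db$ encode each other, the value of $e$ on $\mathcal I$ is encoded by the output of $Q$ on $db$. $Q$ is *well-typed* if its variables can be assigned size symbols such that in each atom $R(z_1,z_2)$ the matrix symbol of $R$ has type $(\tau(z_1),\tau(z_2))$, in each atom $R(z)$ it has type $(\tau(z),1)$ or $(1,\tau(z))$, in each atom $x\le c$ the variable $x$ has the size symbol of $c$, and the head $H(\bar x)$ satisfies the same condition with respect to the type of $\mathbf H$. **Theorem.** qh-MATLANG and binary q-hierarchical CQs are equally expressive, that is: 1. for every qh-MATLANG query $\mathbf H:=e$ over a schema $\mathcal S$ and every schema encoding of $\mathcal S\cup\{\mathbf H\}$ there is a binary q-hierarchical CQ, well-typed with respect to the encoding, that simulates it; 2. for every binary q-hierarchical CQ $Q$ over a vocabulary $\sigma$ with head symbol $H$ and every schema encoding of $\sigma\cup\{H\}$ with respect to which $Q$ is well-typed there is a qh-MATLANG query that simulates $Q$. -/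

import Mathlib

namespace QHMatlang

/-! ### Matrix schemas, matrix instances and MATLANG -/

/-- A matrix schema: a finite set of size symbols containing the special symbol `1`, and a finite
set of matrix symbols `A`, each with its type `(row A, col A)`. -/
structure Schema where
  Size : Type
  Sym : Type
  finSize : Finite Size
  finSym : Finite Sym
  one : Size
  row : Sym → Size
  col : Sym → Size

/-- A matrix instance with entries in `K`. -/
structure Instance (K : Type*) (S : Schema) where
  dim : S.Size → ℕ+
  dim_one : dim S.one = 1
  mat : (A : S.Sym) → Matrix (Fin (dim (S.row A))) (Fin (dim (S.col A))) K

/-- Well-typed MATLANG expressions over the schema `S`: `Expr S a b` are those of type `(a, b)`. -/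
inductive Expr (S : Schema) : S.Size → S.Size → Type
  | sym (A : S.Sym) : Expr S (S.row A) (S.col A)
  | ones (a : S.Size) : Expr S a S.one
  | ident (a : S.Size) : Expr S a a
  | transpose {a b : S.Size} (e : Expr S a b) : Expr S b a
  | mul {a b c : S.Size} (e₁ : Expr S a b) (e₂ : Expr S b c) : Expr S a c
  | add {a b : S.Size} (e₁ e₂ : Expr S a b) : Expr S a b
  | smul {a b : S.Size} (e₁ : Expr S S.one S.one) (e₂ : Expr S a b) : Expr S a b
  | had {a b : S.Size} (e₁ e₂ : Expr S a b) : Expr S a b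

/-- The semantics of MATLANG over a semiring. -/
def Expr.eval {K : Type*} [CommSemiring K] {S : Schema} (I : Instance K S) :
    {a b : S.Size} → Expr S a b → Matrix (Fin (I.dim a)) (Fin (I.dim b)) K
  | _, _, .sym A => I.mat A
  | _, _, .ones _ => fun _ _ => 1
  | _, _, .ident _ => 1
  | _, _, .transpose e => (e.eval I).transpose
  | _, _, .mul e₁ e₂ => e₁.eval I * e₂.eval I
  | _, _, .add e₁ e₂ => e₁.eval I + e₂.eval I
  | _, _, .smul e₁ e₂ => fun i j =>
      e₁.eval I ⟨0, (I.dim S.one).pos⟩ ⟨0, (I.dim S.one).pos⟩ * e₂.eval I i j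
  | _, _, .had e₁ e₂ => fun i j => e₁.eval I i j * e₂.eval I i j

/-- simple-MATLANG: `e ::= A | 1^α | I^α | eᵀ | e₁ × e₂ | e₁ ⊙ e₂ | e · 1^α`. -/
inductive IsSimple {S : Schema} : {a b : S.Size} → Expr S a b → Prop
  | sym (A : S.Sym) : IsSimple (.sym A)
  | ones (a : S.Size) : IsSimple (.ones a)
  | ident (a : S.Size) : IsSimple (.ident a)
  | transpose {a b : S.Size} {e : Expr S a b} : IsSimple e → IsSimple (.transpose e)
  | smul {a b : S.Size} {e₁ : Expr S S.one S.one} {e₂ : Expr S a b} :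
      IsSimple e₁ → IsSimple e₂ → IsSimple (.smul e₁ e₂)
  | had {a b : S.Size} {e₁ e₂ : Expr S a b} : IsSimple e₁ → IsSimple e₂ → IsSimple (.had e₁ e₂)
  | mulOnes {a b : S.Size} {e : Expr S a b} : IsSimple e → IsSimple (.mul e (.ones b))

/-- qh-MATLANG:
`e ::= e₁ | e₁ ⊙ (e₂ · (1^β)ᵀ) | (1^α · e₁) ⊙ e₂ | (1^α · e₁) ⊙ (e₂ · (1^β)ᵀ)`
with `e₁`, `e₂` in simple-MATLANG. -/
inductive IsQH {S : Schema} : {a b : S.Size} → Expr S a b → Prop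
  | simple {a b : S.Size} {e : Expr S a b} : IsSimple e → IsQH e
  | hadCol {a b : S.Size} {e₁ : Expr S a b} {e₂ : Expr S a S.one} :
      IsSimple e₁ → IsSimple e₂ → IsQH (.had e₁ (.mul e₂ (.transpose (.ones b))))
  | rowHad {a b : S.Size} {e₁ : Expr S S.one b} {e₂ : Expr S a b} :
      IsSimple e₁ → IsSimple e₂ → IsQH (.had (.mul (.ones a) e₁) e₂)
  | rowHadCol {a b : S.Size} {e₁ : Expr S S.one b} {e₂ : Expr S a S.one} :
      IsSimple e₁ → IsSimple e₂ →
        IsQH (.had (.mul (.ones a) e₁) (.mul e₂ (.transpose (.ones b))))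

/-! ### Vocabularies, databases and conjunctive first-order logic -/

/-- A vocabulary: a finite set of relation symbols with arities and a finite set of constant
symbols containing the special symbol `1`. -/
structure Vocab where
  Rel : Type
  Const : Type
  finRel : Finite Rel
  finConst : Finite Const
  arity : Rel → ℕ
  one : Const

/-- A database: a positive integer for every constant symbol, and a `K`-relation (a finitely
supported `K`-valued function on tuples of positive integers) for every relation symbol. -/
structure Database (K : Type*) [CommSemiring K] (V : Vocab) where
  const : V.Const → ℕ+
  const_one : const V.one = 1
  rel : (R : V.Rel) → (Fin (V.arity R) → ℕ+) → K
  finite_support : ∀ R, (Function.support (rel R)).Finite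

/-- Formulas built from atoms `R(x₁, …, x_k)` and `x ≤ c` with `∧` and `∃`; the variables are
the natural numbers. -/
inductive Formula (V : Vocab) : Type
  | rel (R : V.Rel) (xs : Fin (V.arity R) → ℕ) : Formula V
  | le (x : ℕ) (c : V.Const) : Formula V
  | and (φ₁ φ₂ : Formula V) : Formula V
  | ex (y : ℕ) (φ : Formula V) : Formula V

/-- The set of free variables. -/
def Formula.free {V : Vocab} : Formula V → Set ℕ
  | .rel _ xs => Set.range xs
  | .le x _ => {x}
  | .and φ₁ φ₂ => φ₁.free ∪ φ₂.free
  | .ex y φ => φ.free \ {y}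

open Classical in
/-- The semiring semantics. Valuations are total, but the value only depends on the free
variables. In `∃ y. φ` the sum ranges over the valuations of the free variables of `φ` that agree
with `ν` off `y`; if `y` is not free in `φ` there is just one. The sums have finite support. -/
noncomputable def Formula.eval {K : Type*} [CommSemiring K] {V : Vocab} (db : Database K V) :
    Formula V → (ℕ → ℕ+) → K
  | .rel R xs, ν => db.rel R (ν ∘ xs)
  | .le x c, ν => if ν x ≤ db.const c then 1 else 0
  | .and φ₁ φ₂, ν => φ₁.eval db ν * φ₂.eval db ν
  | .ex y φ, ν => if y ∈ φ.free then ∑ᶠ d : ℕ+, φ.eval db (Function.update ν y d) else φ.eval db ν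

/-- A query `H(x₁, …, x_k) ← φ`. The head is a sequence of not necessarily distinct variables
that lists exactly the free variables of the body. -/
structure Query (V : Vocab) (k : ℕ) where
  head : Fin k → ℕ
  body : Formula V
  head_free : Set.range head = body.free

open Classical in
/-- The `K`-relation that a query computes for its head symbol. If `d` repeats values as the head
repeats variables, `Function.extend Q.head d 1` is a valuation that maps the head to `d`. -/
noncomputable def Query.output {K : Type*} [CommSemiring K] {V : Vocab} {k : ℕ} (Q : Query V k)
    (db : Database K V) (d : Fin k → ℕ+) : K :=
  if ∀ i j, Q.head i = Q.head j → d i = d j then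
    Q.body.eval db (Function.extend Q.head d fun _ => 1)
  else 0

/-! ### Binary q-hierarchical conjunctive queries -/

/-- Conjunctions of one or more atoms. -/
inductive Formula.IsConj {V : Vocab} : Formula V → Prop
  | rel (R : V.Rel) (xs : Fin (V.arity R) → ℕ) : IsConj (.rel R xs)
  | le (x : ℕ) (c : V.Const) : IsConj (.le x c)
  | and {φ₁ φ₂ : Formula V} : IsConj φ₁ → IsConj φ₂ → IsConj (.and φ₁ φ₂)

/-- Prenex formulas `∃ y₁ … y_m. a₁ ∧ … ∧ a_n`: the bodies of conjunctive queries. -/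
inductive Formula.IsPrenex {V : Vocab} : Formula V → Prop
  | conj {φ : Formula V} : IsConj φ → IsPrenex φ
  | ex {φ : Formula V} (y : ℕ) : IsPrenex φ → IsPrenex (.ex y φ)

/-- The set of relational atoms `R(x₁, …, x_k)` of a formula, as pairs `⟨R, (x₁, …, x_k)⟩`. -/
def Formula.relAtoms {V : Vocab} : Formula V → Set (Σ R : V.Rel, (Fin (V.arity R) → ℕ))
  | .rel R xs => {⟨R, xs⟩}
  | .le _ _ => ∅
  | .and φ₁ φ₂ => φ₁.relAtoms ∪ φ₂.relAtoms
  | .ex _ φ => φ.relAtoms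

/-- The set of relational atoms that mention the variable `x`. -/
def Formula.atomsOf {V : Vocab} (φ : Formula V) (x : ℕ) :
    Set (Σ R : V.Rel, (Fin (V.arity R) → ℕ)) :=
  {a ∈ φ.relAtoms | x ∈ Set.range a.2}

/-- Every relational atom in head or body has arity at most two. -/
def Query.IsBinary {V : Vocab} {k : ℕ} (Q : Query V k) : Prop :=
  k ≤ 2 ∧ ∀ a ∈ Q.body.relAtoms, V.arity a.1 ≤ 2

/-- The q-hierarchical property. It depends only on the relational part of the query: `x` and `y`
range over the variables that occur in relational atoms. -/
def Query.IsQHierarchical {V : Vocab} {k : ℕ} (Q : Query V k) : Prop :=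
  ∀ x y : ℕ, (Q.body.atomsOf x).Nonempty → (Q.body.atomsOf y).Nonempty →
    (Q.body.atomsOf x ⊆ Q.body.atomsOf y ∨ Q.body.atomsOf y ⊆ Q.body.atomsOf x ∨
      Disjoint (Q.body.atomsOf x) (Q.body.atomsOf y)) ∧
    (x ∈ Set.range Q.head → Q.body.atomsOf x ⊂ Q.body.atomsOf y → y ∈ Set.range Q.head)

/-- Binary q-hierarchical conjunctive queries. -/
def Query.IsBinaryQHCQ {V : Vocab} {k : ℕ} (Q : Query V k) : Prop :=
  Q.body.IsPrenex ∧ Q.IsBinary ∧ Q.IsQHierarchical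

/-! ### Encodings between matrices and relations -/

/-- `A ≃ R`: the `K`-relation `R` of arity `k` encodes the `m × n` matrix `A`, whose rows and
columns are numbered from `1`. -/
def Encodes {K : Type*} [CommSemiring K] {m n : ℕ} (A : Matrix (Fin m) (Fin n) K) :
    {k : ℕ} → ((Fin k → ℕ+) → K) → Prop
  | 0, R => m = 1 ∧ n = 1 ∧ ∀ i j, A i j = R ![]
  | 1, R =>
      (n = 1 ∧ (∀ i j, A i j = R ![Nat.succPNat i]) ∧ ∀ p : ℕ+, m < (p : ℕ) → R ![p] = 0) ∨
      (m = 1 ∧ (∀ i j, A i j = R ![Nat.succPNat j]) ∧ ∀ q : ℕ+, n < (q : ℕ) → R ![q] = 0)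
  | 2, R =>
      (∀ i j, A i j = R ![Nat.succPNat i, Nat.succPNat j]) ∧
        ∀ p q : ℕ+, m < (p : ℕ) ∨ n < (q : ℕ) → R ![p, q] = 0
  | _ + 3, _ => False

/-- A relation symbol of arity `k` may stand for a matrix symbol of type `(a, b)`: the arity is at
most two, it is one only for vector types and zero only for the scalar type. -/
def ArityFits (S : Schema) (a b : S.Size) (k : ℕ) : Prop :=
  k ≤ 2 ∧ (k = 1 → a = S.one ∨ b = S.one) ∧ (k = 0 → a = S.one ∧ b = S.one)

/-- A schema encoding between a matrix schema and a vocabulary: a bijection that matches matrix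
symbols with relation symbols of fitting arity, and size symbols with constant symbols, `1` with
`1`. Read from left to right it is a matrix-to-relational encoding, and from right to left a
relational-to-matrix encoding. -/
structure SchemaEncoding (S : Schema) (V : Vocab) where
  rel : S.Sym ≃ V.Rel
  const : S.Size ≃ V.Const
  const_one : const S.one = V.one
  fits : ∀ R, ArityFits S (S.row (rel.symm R)) (S.col (rel.symm R)) (V.arity R)

/-- `I` and `db` encode each other. Given `I` there is exactly one such `db`. Given `db` there is
at most one such `I`, and it exists if and only if `db` is consistent with the encoding. -/
def InstanceEncodes {K : Type*} [CommSemiring K] {S : Schema} {V : Vocab} (E : SchemaEncoding S V)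
    (I : Instance K S) (db : Database K V) : Prop :=
  (∀ R, Encodes (I.mat (E.rel.symm R)) (db.rel R)) ∧ ∀ c, db.const c = I.dim (E.const.symm c)

/-- The matrix query `H := e` and the relational query `Q` simulate each other, the output matrix
symbol of type `(a, b)` being matched with the head symbol of `Q`, of arity `k`. -/
def Simulates (K : Type*) [CommSemiring K] {S : Schema} {V : Vocab} (E : SchemaEncoding S V)
    {a b : S.Size} (e : Expr S a b) {k : ℕ} (Q : Query V k) : Prop :=
  ∀ (I : Instance K S) (db : Database K V), InstanceEncodes E I db →
    Encodes (e.eval I) (Q.output db)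

/-! ### Well-typed queries and equal expressiveness -/

/-- The arguments of an atom whose relation symbol stands for a matrix symbol of type `(a, b)`
have the size symbols `t` as types. -/
def ArgsTyped (S : Schema) (a b : S.Size) : {k : ℕ} → (Fin k → S.Size) → Prop
  | 0, _ => a = S.one ∧ b = S.one
  | 1, t => (a = t 0 ∧ b = S.one) ∨ (a = S.one ∧ b = t 0)
  | 2, t => a = t 0 ∧ b = t 1
  | _ + 3, _ => False

/-- `WellTyped E φ τ`: the formula `φ` is well-typed with respect to the encoding, with the types
`τ x` for its free variables `x`; the values of `τ` at other variables are irrelevant. -/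
inductive WellTyped {S : Schema} {V : Vocab} (E : SchemaEncoding S V) :
    Formula V → (ℕ → S.Size) → Prop
  | rel (R : V.Rel) (xs : Fin (V.arity R) → ℕ) (τ : ℕ → S.Size) :
      ArgsTyped S (S.row (E.rel.symm R)) (S.col (E.rel.symm R)) (τ ∘ xs) →
        WellTyped E (.rel R xs) τ
  | le (x : ℕ) (c : V.Const) (τ : ℕ → S.Size) : τ x = E.const.symm c → WellTyped E (.le x c) τ
  | and {φ₁ φ₂ : Formula V} {τ : ℕ → S.Size} :
      WellTyped E φ₁ τ → WellTyped E φ₂ τ → WellTyped E (.and φ₁ φ₂) τ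
  | ex {φ : Formula V} {y : ℕ} {τ τ' : ℕ → S.Size} :
      WellTyped E φ τ' → (∀ x ∈ φ.free, x ≠ y → τ x = τ' x) → WellTyped E (.ex y φ) τ

/-- The query is well-typed, its head symbol standing for a matrix symbol of type `(a, b)`. -/
def Query.IsWellTyped {S : Schema} {V : Vocab} (E : SchemaEncoding S V) (a b : S.Size) {k : ℕ}
    (Q : Query V k) : Prop :=
  ∃ τ : ℕ → S.Size, WellTyped E Q.body τ ∧ ArgsTyped S a b (τ ∘ Q.head)

/-- A class `LM` of matrix queries `H := e` and a class `LR` of relational queries are equally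
expressive over `K`. A schema encoding of the schema extended by the output symbol is given by an
encoding `E` of the input symbols and the arity `k` of the relation symbol for the output. -/
def EquallyExpressive (K : Type*) [CommSemiring K]
    (LM : ∀ {S : Schema} {a b : S.Size}, Expr S a b → Prop)
    (LR : ∀ {V : Vocab} {k : ℕ}, Query V k → Prop) : Prop :=
  (∀ (S : Schema) (a b : S.Size) (e : Expr S a b), LM e →
    ∀ (V : Vocab) (E : SchemaEncoding S V) (k : ℕ), ArityFits S a b k →
      ∃ Q : Query V k, LR Q ∧ Q.IsWellTyped E a b ∧ Simulates K E e Q) ∧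
  (∀ (V : Vocab) (k : ℕ) (Q : Query V k), LR Q →
    ∀ (S : Schema) (E : SchemaEncoding S V) (a b : S.Size), ArityFits S a b k →
      Q.IsWellTyped E a b → ∃ e : Expr S a b, LM e ∧ Simulates K E e Q)

end QHMatlang

/-!
Both translations go through the following picture of a binary q-hierarchical query. Two variables
that share an atom have comparable sets of atoms (`isQHierarchical_iff`), and atoms have at most
two variables, so that each connected component of the atoms is a star: all atoms of a leaf also
mention the centre. Over consistent databases, quantifiers are finite sums over the ranges given
by the types (`eval_exs`), and a variable of type `1` takes only the value `1`. Hence arguments of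
type `1` do not count as variables of an atom in either direction. To avoid casts between types of
matrices, all values are read off through `entry` and `val`, which extend matrices by `0` to all
positive indices.

*From queries to expressions.* The body is a product of factors, each an entry of the value of a
simple expression over at most two variables (`exists_factors`). Bound variables are eliminated
one at a time, a variable with a minimal set of factors first (`exists_eliminate`). Such a
variable `z` is alone in its factors, whose sum is then a scalar, or its factors are all over `z`
and one other variable `c`, and their sum is a vector over `c`, namely a matrix times the ones
vector; so simple-MATLANG suffices. What remains is a q-hierarchical product over the two head
variables: a matrix times a vector for one of them, or a product of two vectors. These are the
forms of qh-MATLANG (`exists_qh_of_scope_subset_pair`). A repeated head variable gives a diagonal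
matrix, which is an identity matrix times a vector.

*From expressions to queries.* By induction, the value of a simple expression is defined by a
conjunction in which each atom that mentions one of the head variables `0`, `1` of type other than
`1` mentions all of them (`IsSimple.presentable`). This property makes the summation in `e · 1`
produce a q-hierarchical query again (`Presentable.sum`). The exception is a diagonal matrix, for
which the conjunction defines the vector on the diagonal. The remaining forms of qh-MATLANG
multiply by vectors, which keeps the head variables comparable (`exists_query_of_mul`).
-/

namespace QHMatlang

/-! ### Iterated finite sums over variables -/

section Sums

variable {K : Type*} [CommSemiring K]

/-- The sum of `f` over all values of the variables in the list `Y`, where the variable `y` ranges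
over `1, …, D y` and the variables outside `Y` keep their values under `ν`. -/
def sumOver (D : ℕ → ℕ+) : List ℕ → ((ℕ → ℕ+) → K) → (ℕ → ℕ+) → K
  | [], f, ν => f ν
  | y :: Y, f, ν => ∑ d ∈ Finset.Icc 1 (D y), sumOver D Y f (Function.update ν y d)

theorem sumOver_append (D : ℕ → ℕ+) (Y Z : List ℕ) (f : (ℕ → ℕ+) → K) (ν : ℕ → ℕ+) :
    sumOver D (Y ++ Z) f ν = sumOver D Y (sumOver D Z f) ν := by
  induction Y generalizing ν with
  | nil => rfl
  | cons y Y ih => simp only [List.cons_append, sumOver, ih]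

theorem sumOver_perm (D : ℕ → ℕ+) {Y Z : List ℕ} (h : Y.Perm Z) (f : (ℕ → ℕ+) → K)
    (ν : ℕ → ℕ+) : sumOver D Y f ν = sumOver D Z f ν := by
  induction h generalizing ν with
  | nil => rfl
  | cons y _ ih => simp only [sumOver, ih]
  | swap x y l =>
    by_cases h : x = y
    · subst h; rfl
    · simp only [sumOver]
      rw [Finset.sum_comm]
      refine Finset.sum_congr rfl fun d _ => Finset.sum_congr rfl fun d' _ => ?_
      rw [Function.update_comm h]
  | trans _ _ ih₁ ih₂ => rw [ih₁, ih₂]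

theorem sumOver_congr {D : ℕ → ℕ+} (Y : List ℕ) {f g : (ℕ → ℕ+) → K} {ν : ℕ → ℕ+}
    (hν : ∀ x, ν x ≤ D x) (h : ∀ μ : ℕ → ℕ+, (∀ x, μ x ≤ D x) → f μ = g μ) :
    sumOver D Y f ν = sumOver D Y g ν := by
  induction Y generalizing ν with
  | nil => exact h ν hν
  | cons y Y ih =>
    simp only [sumOver]
    refine Finset.sum_congr rfl fun d hd => ih fun x => ?_
    by_cases hx : x = y
    · subst hx; simpa using (Finset.mem_Icc.1 hd).2
    · simpa [hx] using hν x

theorem sumOver_congr_bound {D D' : ℕ → ℕ+} (Y : List ℕ) (h : ∀ y ∈ Y, D y = D' y)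
    (f : (ℕ → ℕ+) → K) (ν : ℕ → ℕ+) : sumOver D Y f ν = sumOver D' Y f ν := by
  induction Y generalizing ν with
  | nil => rfl
  | cons y Y ih =>
    simp only [sumOver, h y (by simp)]
    exact Finset.sum_congr rfl fun d _ => ih (fun z hz => h z (by simp [hz])) _

theorem sumOver_eq_zero (D : ℕ → ℕ+) {Y : List ℕ} {f : (ℕ → ℕ+) → K} {ν : ℕ → ℕ+} {y : ℕ}
    (hy : y ∉ Y) (h : ∀ μ : ℕ → ℕ+, μ y = ν y → f μ = 0) : sumOver D Y f ν = 0 := by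
  induction Y generalizing ν with
  | nil => exact h ν rfl
  | cons z Y ih =>
    simp only [List.mem_cons, not_or] at hy
    refine Finset.sum_eq_zero fun d _ => ih hy.2 fun μ hμ => h μ ?_
    rw [hμ, Function.update_of_ne hy.1]

theorem sumOver_mul_left (D : ℕ → ℕ+) {Y : List ℕ} {g : (ℕ → ℕ+) → K}
    (hg : ∀ y ∈ Y, ∀ μ d, g (Function.update μ y d) = g μ) (f : (ℕ → ℕ+) → K) (ν : ℕ → ℕ+) :
    sumOver D Y (fun μ => g μ * f μ) ν = g ν * sumOver D Y f ν := by
  induction Y generalizing ν with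
  | nil => rfl
  | cons y Y ih =>
    simp only [sumOver, Finset.mul_sum]
    refine Finset.sum_congr rfl fun d _ => ?_
    rw [ih (fun z hz => hg z (by simp [hz])), hg y (by simp)]

/-- Renaming variables. The renaming may identify variables, as long as it keeps each summation
variable apart from all others. -/
theorem sumOver_map (D : ℕ → ℕ+) {Y : List ℕ} {ρ : ℕ → ℕ}
    (hρ : ∀ y ∈ Y, ∀ n, ρ n = ρ y → n = y) (f : (ℕ → ℕ+) → K) (ν : ℕ → ℕ+) :
    sumOver D (Y.map ρ) (fun μ => f (μ ∘ ρ)) ν = sumOver (D ∘ ρ) Y f (ν ∘ ρ) := by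
  induction Y generalizing ν with
  | nil => rfl
  | cons y Y ih =>
    simp only [List.map_cons, sumOver, Function.comp_apply]
    refine Finset.sum_congr rfl fun d _ => ?_
    rw [ih (fun z hz => hρ z (by simp [hz]))]
    congr 1
    funext n
    by_cases hn : n = y
    · simp [hn]
    · have : ρ n ≠ ρ y := fun h => hn (hρ y (by simp) n h)
      simp [hn, this]

theorem finsum_eq_sum_Icc {D : ℕ+} {g : ℕ+ → K} (h : ∀ d, D < d → g d = 0) :
    ∑ᶠ d, g d = ∑ d ∈ Finset.Icc 1 D, g d := by
  refine finsum_eq_sum_of_support_subset _ fun d hd => ?_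
  simp only [Finset.coe_Icc, Set.mem_Icc, one_le, true_and]
  by_contra hlt
  exact hd (h d (not_le.1 hlt))

theorem sum_Icc_dim_one {S : Schema} (I : Instance K S) (g : ℕ+ → K) :
    ∑ d ∈ Finset.Icc 1 (I.dim S.one), g d = g 1 := by
  simp [I.dim_one]

end Sums

/-! ### Matrices as functions on pairs of positive integers -/

section Entries

variable {K : Type*} [CommSemiring K]

/-- The entry of `A` in row `p` and column `q`, numbered from `1`, and `0` outside the matrix.
The type of `entry A` does not depend on the format of `A`. -/
def entry {m n : ℕ} (A : Matrix (Fin m) (Fin n) K) (p q : ℕ+) : K :=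
  if h : p.natPred < m ∧ q.natPred < n then A ⟨p.natPred, h.1⟩ ⟨q.natPred, h.2⟩ else 0

theorem natPred_lt_iff (p : ℕ+) (m : ℕ) : p.natPred < m ↔ (p : ℕ) ≤ m := by
  have := PNat.natPred_add_one p
  omega

theorem natPred_lt_pnat_iff (p m : ℕ+) : p.natPred < m ↔ p ≤ m := natPred_lt_iff p m

theorem entry_succPNat {m n : ℕ} (A : Matrix (Fin m) (Fin n) K) (i : Fin m) (j : Fin n) :
    entry A (Nat.succPNat i) (Nat.succPNat j) = A i j := by
  simp [entry]

theorem entry_eq_zero {m n : ℕ} (A : Matrix (Fin m) (Fin n) K) {p q : ℕ+}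
    (h : m < (p : ℕ) ∨ n < (q : ℕ)) : entry A p q = 0 := by
  rw [entry, dif_neg]
  rw [natPred_lt_iff, natPred_lt_iff]
  omega

theorem encodes_two {m n : ℕ} {A : Matrix (Fin m) (Fin n) K} {R : (Fin 2 → ℕ+) → K} :
    Encodes A R ↔ ∀ d, R d = entry A (d 0) (d 1) := by
  constructor
  · rintro ⟨h₁, h₂⟩ d
    have hd : d = ![d 0, d 1] := by ext i; fin_cases i <;> rfl
    by_cases h : (d 0).natPred < m ∧ (d 1).natPred < n
    · have := h₁ ⟨_, h.1⟩ ⟨_, h.2⟩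
      simp only [PNat.succPNat_natPred, ← hd] at this
      rw [entry, dif_pos h, this]
    · rw [entry, dif_neg h, hd]
      apply h₂
      rw [natPred_lt_iff, natPred_lt_iff] at h
      omega
  · intro h
    refine ⟨fun i j => ?_, fun p q hpq => ?_⟩
    · rw [h]; exact (entry_succPNat A i j).symm
    · rw [h]; exact entry_eq_zero A hpq

theorem encodes_one_of_col {m n : ℕ} (hn : n = 1) {A : Matrix (Fin m) (Fin n) K}
    {R : (Fin 1 → ℕ+) → K} : Encodes A R ↔ ∀ d, R d = entry A (d 0) 1 := by
  subst hn
  constructor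
  · intro H d
    have hd : d = ![d 0] := by ext i; fin_cases i; rfl
    by_cases h : (d 0).natPred < m
    · rw [entry, dif_pos ⟨h, by simp [PNat.natPred]⟩]
      rcases H with ⟨-, h₁, -⟩ | ⟨rfl, h₁, -⟩
      · have := h₁ ⟨_, h⟩ 0
        simp only [PNat.succPNat_natPred, ← hd] at this
        exact this.symm
      · have h1 : d 0 = 1 := by
          rw [← PNat.succPNat_natPred (d 0), Nat.lt_one_iff.1 h]; rfl
        calc R d = R ![1] := by rw [hd, h1]
          _ = A 0 0 := (h₁ 0 0).symm
          _ = _ := by congr 1; exact Subsingleton.elim _ _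
    · rw [natPred_lt_iff] at h
      rw [entry_eq_zero A (Or.inl (not_le.1 h)), hd]
      rcases H with ⟨-, -, h₂⟩ | ⟨rfl, -, h₂⟩
      · exact h₂ _ (not_le.1 h)
      · exact h₂ _ (not_le.1 h)
  · intro h
    refine Or.inl ⟨rfl, fun i j => ?_, fun p hp => ?_⟩
    · rw [h, Subsingleton.elim j 0]; exact (entry_succPNat A i 0).symm
    · rw [h]; exact entry_eq_zero A (Or.inl hp)

theorem entry_transpose {m n : ℕ} (A : Matrix (Fin m) (Fin n) K) (p q : ℕ+) :
    entry A.transpose p q = entry A q p := by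
  simp only [entry, Matrix.transpose_apply, and_comm]

theorem encodes_one_of_row {m n : ℕ} (hm : m = 1) {A : Matrix (Fin m) (Fin n) K}
    {R : (Fin 1 → ℕ+) → K} : Encodes A R ↔ ∀ d, R d = entry A 1 (d 0) := by
  have h : Encodes A R ↔ Encodes A.transpose R := by
    simp only [Encodes, Matrix.transpose_apply]
    rw [or_comm]
    refine or_congr ?_ ?_ <;> refine and_congr_right fun _ => and_congr_left fun _ => forall_comm
  rw [h, encodes_one_of_col hm]
  simp only [entry_transpose]

theorem encodes_zero {m n : ℕ} (hm : m = 1) (hn : n = 1) {A : Matrix (Fin m) (Fin n) K}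
    {R : (Fin 0 → ℕ+) → K} : Encodes A R ↔ ∀ d, R d = entry A 1 1 := by
  subst hm hn
  have e : entry A 1 1 = A 0 0 := entry_succPNat A 0 0
  rw [e]
  constructor
  · rintro ⟨-, -, h⟩ d
    rw [h 0 0, Subsingleton.elim d]
  · intro h
    refine ⟨rfl, rfl, fun i j => ?_⟩
    rw [h, Subsingleton.elim i 0, Subsingleton.elim j 0]

/-- The value of an expression at row `p` and column `q`. -/
def val {S : Schema} (I : Instance K S) {a b : S.Size} (e : Expr S a b) (p q : ℕ+) : K :=
  entry (e.eval I) p q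

variable {S : Schema} (I : Instance K S) {a b c : S.Size}

theorem val_of_le (e : Expr S a b) {p q : ℕ+} (hp : p.natPred < I.dim a)
    (hq : q.natPred < I.dim b) : val I e p q = e.eval I ⟨p.natPred, hp⟩ ⟨q.natPred, hq⟩ :=
  dif_pos ⟨hp, hq⟩

theorem val_eq_zero_of_row {p : ℕ+} (h : ¬ p ≤ I.dim a) (e : Expr S a b) (q : ℕ+) :
    val I e p q = 0 :=
  entry_eq_zero _ (Or.inl (not_le.1 h))

theorem val_eq_zero_of_col {q : ℕ+} (h : ¬ q ≤ I.dim b) (e : Expr S a b) (p : ℕ+) :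
    val I e p q = 0 :=
  entry_eq_zero _ (Or.inr (not_le.1 h))

theorem le_of_val_ne_zero {e : Expr S a b} {p q : ℕ+} (h : val I e p q ≠ 0) :
    p ≤ I.dim a ∧ q ≤ I.dim b := by
  by_contra hn
  rcases not_and_or.1 hn with hn | hn
  · exact h (val_eq_zero_of_row I hn e q)
  · exact h (val_eq_zero_of_col I hn e p)

theorem val_transpose (e : Expr S a b) (p q : ℕ+) : val I e.transpose p q = val I e q p :=
  entry_transpose _ _ _

theorem val_had (e₁ e₂ : Expr S a b) (p q : ℕ+) :
    val I (e₁.had e₂) p q = val I e₁ p q * val I e₂ p q := by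
  simp only [val, entry, Expr.eval]
  split_ifs <;> simp

theorem val_smul (e₁ : Expr S S.one S.one) (e₂ : Expr S a b) (p q : ℕ+) :
    val I (e₁.smul e₂) p q = val I e₁ 1 1 * val I e₂ p q := by
  have h1 : (1 : ℕ+).natPred < I.dim S.one := (natPred_lt_pnat_iff _ _).2 one_le
  rw [val_of_le I e₁ h1 h1]
  simp only [val, entry, Expr.eval]
  split_ifs
  · rfl
  · simp

theorem val_ones (p : ℕ+) :
    val I (.ones a) p 1 = if p ≤ I.dim a then 1 else 0 := by
  split_ifs with h
  · rw [val_of_le I _ ((natPred_lt_pnat_iff _ _).2 h)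
      ((natPred_lt_pnat_iff _ _).2 one_le)]
    rfl
  · exact val_eq_zero_of_row I h _ _

theorem val_ident (p q : ℕ+) :
    val I (.ident a) p q = if p = q then (if p ≤ I.dim a then 1 else 0) else 0 := by
  by_cases hp : p ≤ I.dim a
  · by_cases hq : q ≤ I.dim a
    · rw [val_of_le I _ ((natPred_lt_pnat_iff _ _).2 hp) ((natPred_lt_pnat_iff _ _).2 hq)]
      simp [Expr.eval, Matrix.one_apply, hp, PNat.natPred_inj]
    · rw [val_eq_zero_of_col I hq, if_neg]
      rintro rfl
      exact hq hp
  · rw [val_eq_zero_of_row I hp]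
    simp [hp]

theorem sum_Icc_eq_sum_fin (m : ℕ+) (g : ℕ+ → K) :
    ∑ z ∈ Finset.Icc 1 m, g z = ∑ k : Fin m, g (Nat.succPNat k) := by
  symm
  refine Finset.sum_bij' (fun k _ => Nat.succPNat k)
    (fun z hz => ⟨z.natPred, (natPred_lt_pnat_iff _ _).2 (Finset.mem_Icc.1 hz).2⟩) ?_ ?_ ?_ ?_ ?_
  · intro k _
    simp only [Finset.mem_Icc, one_le, true_and]
    rw [← natPred_lt_pnat_iff]
    simp
  all_goals simp

theorem val_mul (e₁ : Expr S a b) (e₂ : Expr S b c) (p q : ℕ+) :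
    val I (e₁.mul e₂) p q = ∑ z ∈ Finset.Icc 1 (I.dim b), val I e₁ p z * val I e₂ z q := by
  by_cases hp : p.natPred < I.dim a
  · by_cases hq : q.natPred < I.dim c
    · rw [val_of_le I _ hp hq, sum_Icc_eq_sum_fin]
      simp only [Expr.eval, Matrix.mul_apply]
      refine Finset.sum_congr rfl fun k _ => ?_
      have hk : (Nat.succPNat k).natPred < I.dim b := by simp
      rw [val_of_le I _ hp hk, val_of_le I _ hk hq]
      simp
    · rw [natPred_lt_pnat_iff] at hq
      simp [val_eq_zero_of_col I hq]
  · rw [natPred_lt_pnat_iff] at hp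
    simp [val_eq_zero_of_row I hp]

theorem val_mul_ones (e : Expr S a b) (p : ℕ+) :
    val I (e.mul (.ones b)) p 1 = ∑ z ∈ Finset.Icc 1 (I.dim b), val I e p z := by
  rw [val_mul]
  refine Finset.sum_congr rfl fun z hz => ?_
  rw [val_ones, if_pos (Finset.mem_Icc.1 hz).2, mul_one]

/-- The matrix that repeats a column vector. -/
theorem val_mul_transpose_ones (e : Expr S a S.one) (p : ℕ+) {q : ℕ+} (hq : q ≤ I.dim b) :
    val I (e.mul (.transpose (.ones b))) p q = val I e p 1 := by
  rw [val_mul, sum_Icc_dim_one, val_transpose, val_ones, if_pos hq, mul_one]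

/-- The matrix that repeats a row vector. -/
theorem val_ones_mul (e : Expr S S.one b) {p : ℕ+} (q : ℕ+) (hp : p ≤ I.dim a) :
    val I ((Expr.ones a).mul e) p q = val I e 1 q := by
  rw [val_mul, sum_Icc_dim_one, val_ones, if_pos hp, one_mul]

end Entries

/-! ### Atoms, conjunctions and prenex formulas -/

section Formulas

variable {K : Type*} [CommSemiring K] {S : Schema} {V : Vocab} {E : SchemaEncoding S V}

/-- A relation symbol that fits a matrix symbol of type `(a, b)` has at most one argument place `r`
for the row and at most one argument place `c` for the column. The row or column of a missing
place is the only one. -/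
theorem ArityFits.exists_places (K : Type*) [CommSemiring K] {a b : S.Size} {k : ℕ}
    (h : ArityFits S a b k) :
    ∃ r c : Option (Fin k), (∀ i, r = some i ∨ c = some i) ∧ (r = c → r = none) ∧
      (r = none → a = S.one) ∧ (c = none → b = S.one) ∧
      (∀ t : Fin k → S.Size, ArgsTyped S a b t ↔ a = r.elim S.one t ∧ b = c.elim S.one t) ∧
      ∀ (I : Instance K S) (A : Matrix (Fin (I.dim a)) (Fin (I.dim b)) K) (R : (Fin k → ℕ+) → K),
        Encodes A R ↔ ∀ d, R d = entry A (r.elim 1 d) (c.elim 1 d) := by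
  obtain ⟨hk, h₁, h₀⟩ := h
  have dim_one (I : Instance K S) : (I.dim S.one : ℕ) = 1 := by rw [I.dim_one]; rfl
  interval_cases k
  · obtain ⟨rfl, rfl⟩ := h₀ rfl
    exact ⟨none, none, fun i => i.elim0, fun _ => rfl, fun _ => rfl, fun _ => rfl,
      fun t => Iff.rfl, fun I A R => encodes_zero (dim_one I) (dim_one I)⟩
  · by_cases hb : b = S.one
    · subst hb
      refine ⟨some 0, none, fun i => Or.inl (by rw [Subsingleton.elim i 0]), by simp, by simp,
        fun _ => rfl, fun t => ?_, fun I A R => encodes_one_of_col (dim_one I)⟩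
      simp only [ArgsTyped, Option.elim, and_true, or_iff_left_iff_imp]
      rintro ⟨rfl, h⟩
      exact h
    · obtain rfl := (h₁ rfl).resolve_right hb
      refine ⟨none, some 0, fun i => Or.inr (by rw [Subsingleton.elim i 0]), by simp,
        fun _ => rfl, by simp, fun t => ?_, fun I A R => encodes_one_of_row (dim_one I)⟩
      simp [ArgsTyped, hb]
  · refine ⟨some 0, some 1, fun i => ?_, by simp, by simp, by simp, fun t => Iff.rfl,
      fun I A R => encodes_two⟩
    fin_cases i <;> simp

theorem InstanceEncodes.exists_places (E : SchemaEncoding S V) (R : V.Rel) :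
    ∃ r c : Option (Fin (V.arity R)), (∀ i, r = some i ∨ c = some i) ∧ (r = c → r = none) ∧
      (r = none → S.row (E.rel.symm R) = S.one) ∧ (c = none → S.col (E.rel.symm R) = S.one) ∧
      (∀ t : Fin (V.arity R) → S.Size,
        ArgsTyped S (S.row (E.rel.symm R)) (S.col (E.rel.symm R)) t ↔
          S.row (E.rel.symm R) = r.elim S.one t ∧ S.col (E.rel.symm R) = c.elim S.one t) ∧
      ∀ (I : Instance K S) (db : Database K V), InstanceEncodes E I db →
        ∀ d, db.rel R d = val I (.sym (E.rel.symm R)) (r.elim 1 d) (c.elim 1 d) := by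
  obtain ⟨r, c, h₁, h₂, h₃, h₄, h₅, h₆⟩ := (E.fits R).exists_places K
  exact ⟨r, c, h₁, h₂, h₃, h₄, h₅, fun I db h => (h₆ I _ _).1 (h.1 R)⟩

/-- The value of a well-typed conjunction is `0` unless all its variables are in the ranges that
their types give them. -/
theorem le_dim_of_eval_ne_zero {I : Instance K S} {db : Database K V}
    (hI : InstanceEncodes E I db) {φ : Formula V} (hφ : φ.IsConj) {τ : ℕ → S.Size}
    (ht : WellTyped E φ τ) {ν : ℕ → ℕ+} (hν : φ.eval db ν ≠ 0) :
    ∀ x ∈ φ.free, ν x ≤ I.dim (τ x) := by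
  induction hφ with
  | rel R xs =>
    cases ht with
    | rel _ _ _ ht =>
      obtain ⟨r, c, h₁, -, -, -, h₅, h₆⟩ := InstanceEncodes.exists_places (K := K) E R
      obtain ⟨hr, hc⟩ := (h₅ _).1 ht
      rw [Formula.eval, h₆ I db hI] at hν
      have := le_of_val_ne_zero I hν
      rintro _ ⟨i, rfl⟩
      rcases h₁ i with rfl | rfl
      · rw [hr] at this; exact this.1
      · rw [hc] at this; exact this.2
  | le x c =>
    cases ht with
    | le _ _ _ ht =>
      rintro _ rfl
      rw [ht, ← hI.2]
      by_contra h
      exact hν (if_neg h)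
  | and _ _ ih₁ ih₂ =>
    cases ht with
    | and ht₁ ht₂ =>
      rintro x (hx | hx)
      · exact ih₁ ht₁ (left_ne_zero_of_mul hν) x hx
      · exact ih₂ ht₂ (right_ne_zero_of_mul hν) x hx

/-- The formula `∃ y₁ … y_m. φ`. -/
def Formula.exs (Y : List ℕ) (φ : Formula V) : Formula V := Y.foldr .ex φ

theorem Formula.free_exs (Y : List ℕ) (φ : Formula V) :
    (Formula.exs Y φ).free = φ.free \ {n | n ∈ Y} := by
  induction Y with
  | nil => simp [Formula.exs]
  | cons y Y ih =>
    change (Formula.exs Y φ).free \ {y} = _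
    rw [ih]
    ext n
    simp only [Set.mem_sdiff, Set.mem_ofPred_eq, Set.mem_singleton_iff, List.mem_cons]
    tauto

theorem Formula.relAtoms_exs (Y : List ℕ) (φ : Formula V) :
    (Formula.exs Y φ).relAtoms = φ.relAtoms := by
  induction Y with
  | nil => rfl
  | cons y Y ih => exact ih

theorem Formula.IsConj.isPrenex_exs {φ : Formula V} (h : φ.IsConj) (Y : List ℕ) :
    (Formula.exs Y φ).IsPrenex := by
  induction Y with
  | nil => exact .conj h
  | cons y Y ih => exact .ex y ih

theorem WellTyped.exs {φ : Formula V} {τ : ℕ → S.Size} (h : WellTyped E φ τ) (Y : List ℕ) :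
    WellTyped E (Formula.exs Y φ) τ := by
  induction Y with
  | nil => exact h
  | cons y Y ih => exact .ex ih fun _ _ _ => rfl

/-- Over consistent databases the quantifiers of a well-typed formula are finite sums over the
ranges given by the types. -/
theorem eval_exs {I : Instance K S} {db : Database K V} (hI : InstanceEncodes E I db)
    {φ : Formula V} (hφ : φ.IsConj) {τ : ℕ → S.Size} (ht : WellTyped E φ τ) {Y : List ℕ}
    (hY : Y.Nodup) (hf : ∀ y ∈ Y, y ∈ φ.free) (ν : ℕ → ℕ+) :
    (Formula.exs Y φ).eval db ν = sumOver (fun x => I.dim (τ x)) Y (φ.eval db) ν := by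
  induction Y generalizing ν with
  | nil => rfl
  | cons y Y ih =>
    obtain ⟨hy, hY⟩ := List.nodup_cons.1 hY
    have hyf : y ∈ (Formula.exs Y φ).free := by
      rw [Formula.free_exs]
      exact ⟨hf y (by simp), hy⟩
    have ih' := ih hY fun z hz => hf z (by simp [hz])
    change Formula.eval db (.ex y (Formula.exs Y φ)) ν = _
    rw [Formula.eval, if_pos hyf]
    simp only [ih', sumOver]
    refine finsum_eq_sum_Icc fun d hd => sumOver_eq_zero _ hy fun μ hμ => ?_
    by_contra h0
    have := le_dim_of_eval_ne_zero hI hφ ht h0 y (hf y (by simp))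
    rw [hμ, Function.update_self] at this
    exact absurd this (not_le.2 hd)

/-- A well-typed prenex formula has a form in which every quantifier binds a different free
variable of the conjunction, and with one typing for all variables. -/
theorem Formula.IsPrenex.exists_exs (K : Type*) [CommSemiring K] {ψ : Formula V}
    (hψ : ψ.IsPrenex) {τ : ℕ → S.Size} (ht : WellTyped E ψ τ) :
    ∃ (φ : Formula V) (Y : List ℕ) (τ' : ℕ → S.Size), φ.IsConj ∧ WellTyped E φ τ' ∧ Y.Nodup ∧
      (∀ y ∈ Y, y ∈ φ.free) ∧ ψ.free = φ.free \ {n | n ∈ Y} ∧ ψ.relAtoms = φ.relAtoms ∧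
      (∀ x ∈ ψ.free, τ x = τ' x) ∧
      ∀ (db : Database K V) (ν : ℕ → ℕ+), ψ.eval db ν = (Formula.exs Y φ).eval db ν := by
  induction hψ generalizing τ with
  | @conj φ h =>
    exact ⟨φ, [], τ, h, ht, by simp, by simp, by simp, rfl, fun _ _ => rfl, fun _ _ => rfl⟩
  | @ex ψ y hψ ih =>
    cases ht with
    | ex ht hτ =>
      obtain ⟨φ, Y, τ', h₁, h₂, h₃, h₄, h₅, h₆, h₇, h₈⟩ := ih ht
      by_cases hy : y ∈ ψ.free
      · have hy' := hy
        rw [h₅] at hy'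
        refine ⟨φ, y :: Y, τ', h₁, h₂, List.nodup_cons.2 ⟨hy'.2, h₃⟩, ?_, ?_, h₆, ?_, ?_⟩
        · simpa using ⟨hy'.1, h₄⟩
        · change ψ.free \ {y} = _
          rw [← Formula.free_exs, h₅, ← Formula.free_exs]
          rfl
        · rintro x ⟨hx, hxy⟩
          rw [hτ x hx hxy, h₇ x hx]
        · intro db ν
          change _ = Formula.eval db (.ex y (Formula.exs Y φ)) ν
          rw [Formula.eval, Formula.eval, Formula.free_exs, ← h₅, if_pos hy, if_pos hy]
          simp only [h₈]
      · refine ⟨φ, Y, τ', h₁, h₂, h₃, h₄, ?_, h₆, ?_, ?_⟩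
        · rw [← h₅]
          exact Set.sdiff_singleton_eq_self hy
        · rintro x ⟨hx, hxy⟩
          rw [hτ x hx hxy, h₇ x hx]
        · intro db ν
          rw [Formula.eval, if_neg hy, h₈]

/-- The sets of variables of the relational atoms of a formula. -/
def Formula.scopes (φ : Formula V) : Set (Set ℕ) := (fun a => Set.range a.2) '' φ.relAtoms

/-- Every atom that mentions the variable `u` mentions `v`, for the sets of variables `𝒮` of the
atoms. -/
def Below (𝒮 : Set (Set ℕ)) (u v : ℕ) : Prop := ∀ s ∈ 𝒮, u ∈ s → v ∈ s

theorem atomsOf_subset_iff {φ : Formula V} {u v : ℕ} :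
    φ.atomsOf u ⊆ φ.atomsOf v ↔ Below φ.scopes u v := by
  constructor
  · rintro h _ ⟨a, ha, rfl⟩ hu
    exact (h ⟨ha, hu⟩).2
  · rintro h a ⟨ha, hu⟩
    exact ⟨ha, h _ ⟨a, ha, rfl⟩ hu⟩

/-- The q-hierarchical property in terms of the sets of variables `𝒮` of the atoms, with `B` the
set of the bound variables: if two variables share an atom, then all atoms of one of them mention
the other, and that one is bound if the other is. -/
def QHier (𝒮 : Set (Set ℕ)) (B : Set ℕ) : Prop :=
  ∀ s ∈ 𝒮, ∀ u ∈ s, ∀ v ∈ s, u ≠ v →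
    ((v ∈ B → u ∈ B) ∧ Below 𝒮 u v) ∨ ((u ∈ B → v ∈ B) ∧ Below 𝒮 v u)

theorem isQHierarchical_iff {k : ℕ} (Q : Query V k) :
    Q.IsQHierarchical ↔ QHier Q.body.scopes {x | x ∉ Set.range Q.head} := by
  simp only [Query.IsQHierarchical, atomsOf_subset_iff, ssubset_iff_subset_not_subset]
  constructor
  · rintro h _ ⟨a, ha, rfl⟩ u hu v hv huv
    have hau : a ∈ Q.body.atomsOf u := ⟨ha, hu⟩
    have hav : a ∈ Q.body.atomsOf v := ⟨ha, hv⟩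
    obtain ⟨h₁, h₂⟩ := h u v ⟨a, hau⟩ ⟨a, hav⟩
    obtain ⟨-, h₃⟩ := h v u ⟨a, hav⟩ ⟨a, hau⟩
    have h₁ := (or_assoc.2 h₁).resolve_right fun hd => Set.disjoint_left.1 hd hau hav
    simp only [Set.mem_ofPred_eq]
    clear h hau hav
    generalize Below Q.body.scopes u v = P at *
    generalize Below Q.body.scopes v u = P' at *
    tauto
  · intro h x y hx hy
    by_cases hxy : x = y
    · subst hxy
      exact ⟨Or.inl fun _ _ h => h, fun h _ => h⟩
    by_cases hd : Disjoint (Q.body.atomsOf x) (Q.body.atomsOf y)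
    · refine ⟨Or.inr (Or.inr hd), fun _ hs => ?_⟩
      obtain ⟨a, ha⟩ := hx
      exact absurd (atomsOf_subset_iff.2 hs.1 ha) (Set.disjoint_left.1 hd ha)
    · obtain ⟨a, hax, hay⟩ := Set.not_disjoint_iff.1 hd
      have := h _ ⟨a, hax.1, rfl⟩ x hax.2 y hay.2 hxy
      simp only [Set.mem_ofPred_eq] at this
      clear h hx hy hd hax hay
      generalize Below Q.body.scopes x y = P at *
      generalize Below Q.body.scopes y x = P' at *
      tauto

end Formulas

/-! ### Factors given by simple expressions -/

section Factors

variable {K : Type*} [CommSemiring K] {S : Schema} {τ : ℕ → S.Size}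

/-- A factor of a product over variables `x` of types `τ x`: an entry of the value of a
simple-MATLANG expression, where up to two variables select the row and the column. -/
inductive Factor (S : Schema) (τ : ℕ → S.Size) : Type
  | scalar (e : Expr S S.one S.one) (h : IsSimple e) : Factor S τ
  | vec (x : ℕ) (e : Expr S (τ x) S.one) (h : IsSimple e) : Factor S τ
  | edge (x y : ℕ) (hxy : x ≠ y) (e : Expr S (τ x) (τ y)) (h : IsSimple e) : Factor S τ

/-- The variables of a factor. -/
def Factor.scope : Factor S τ → Set ℕ
  | .scalar _ _ => ∅
  | .vec x _ _ => {x}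
  | .edge x y _ _ _ => {x, y}

/-- The value of a factor under a valuation. -/
def Factor.value (I : Instance K S) (ν : ℕ → ℕ+) : Factor S τ → K
  | .scalar e _ => val I e 1 1
  | .vec x e _ => val I e (ν x) 1
  | .edge x y _ e _ => val I e (ν x) (ν y)

/-- The product of the values of a list of factors. -/
def prodValue (I : Instance K S) (F : List (Factor S τ)) (ν : ℕ → ℕ+) : K :=
  (F.map (Factor.value I ν)).prod

/-- The sets of variables of a list of factors. -/
def scopesOf (F : List (Factor S τ)) : Set (Set ℕ) := {s | ∃ f ∈ F, s = f.scope}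

theorem prodValue_cons (I : Instance K S) (f : Factor S τ) (F : List (Factor S τ))
    (ν : ℕ → ℕ+) : prodValue I (f :: F) ν = f.value I ν * prodValue I F ν := by
  simp [prodValue]

theorem prodValue_append (I : Instance K S) (F G : List (Factor S τ)) (ν : ℕ → ℕ+) :
    prodValue I (F ++ G) ν = prodValue I F ν * prodValue I G ν := by
  simp [prodValue]

open Classical in
theorem exists_split (F : List (Factor S τ)) (x : ℕ) :
    ∃ G H : List (Factor S τ), (∀ f, f ∈ G ↔ f ∈ F ∧ x ∈ f.scope) ∧
      (∀ f, f ∈ H ↔ f ∈ F ∧ x ∉ f.scope) ∧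
      ∀ (I : Instance K S) ν, prodValue I F ν = prodValue I G ν * prodValue I H ν := by
  refine ⟨F.filter (x ∈ ·.scope), F.filter (x ∉ ·.scope), by simp, by simp, fun I ν => ?_⟩
  induction F with
  | nil => simp [prodValue]
  | cons f F ih =>
    rw [prodValue_cons, ih]
    by_cases h : x ∈ f.scope
    · simp [h, prodValue_cons, mul_assoc]
    · simp [h, prodValue_cons, mul_left_comm]

theorem Factor.value_update {f : Factor S τ} {x : ℕ} (hx : x ∉ f.scope) (I : Instance K S)
    (ν : ℕ → ℕ+) (d : ℕ+) : f.value I (Function.update ν x d) = f.value I ν := by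
  cases f with
  | scalar e h => rfl
  | vec y e h =>
    have : y ≠ x := fun h => hx (by simp [Factor.scope, h])
    simp [Factor.value, this]
  | edge y z hyz e h =>
    have h₁ : y ≠ x := fun h => hx (by simp [Factor.scope, h])
    have h₂ : z ≠ x := fun h => hx (by simp [Factor.scope, h])
    simp [Factor.value, h₁, h₂]

theorem prodValue_update {F : List (Factor S τ)} {x : ℕ} (hx : ∀ f ∈ F, x ∉ f.scope)
    (I : Instance K S) (ν : ℕ → ℕ+) (d : ℕ+) :
    prodValue I F (Function.update ν x d) = prodValue I F ν := by
  unfold prodValue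
  congr 1
  exact List.map_congr_left fun f hf => Factor.value_update (hx f hf) I ν d

theorem exists_simple_of_scope_eq_empty (F : List (Factor S τ)) (hF : ∀ f ∈ F, f.scope = ∅) :
    ∃ e : Expr S S.one S.one, IsSimple e ∧
      ∀ (I : Instance K S) ν, prodValue I F ν = val I e 1 1 := by
  induction F with
  | nil => exact ⟨.ones _, .ones _, fun I ν => by simp [prodValue, val_ones]⟩
  | cons f F ih =>
    obtain ⟨e, he, hv⟩ := ih fun g hg => hF g (by simp [hg])
    have hf := hF f (by simp)
    cases f with
    | scalar e' h' =>
      exact ⟨_, .smul h' he, fun I ν => by rw [prodValue_cons, hv, val_smul]; rfl⟩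
    | vec x e' h' => simp [Factor.scope] at hf
    | edge x y _ e' h' => exact absurd hf (Set.insert_nonempty _ _).ne_empty

theorem exists_simple_of_scope_subset_singleton (x : ℕ) (F : List (Factor S τ))
    (hF : ∀ f ∈ F, f.scope ⊆ {x}) :
    ∃ e : Expr S (τ x) S.one, IsSimple e ∧
      ∀ (I : Instance K S) (ν : ℕ → ℕ+), ν x ≤ I.dim (τ x) →
        prodValue I F ν = val I e (ν x) 1 := by
  induction F with
  | nil => exact ⟨.ones _, .ones _, fun I ν h => by simp [prodValue, val_ones, h]⟩
  | cons f F ih =>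
    obtain ⟨e, he, hv⟩ := ih fun g hg => hF g (by simp [hg])
    have hf := hF f (by simp)
    cases f with
    | scalar e' h' =>
      exact ⟨_, .smul h' he, fun I ν h => by rw [prodValue_cons, hv I ν h, val_smul]; rfl⟩
    | vec y e' h' =>
      obtain rfl : y = x := by simpa [Factor.scope] using hf
      exact ⟨_, .had h' he, fun I ν h => by rw [prodValue_cons, hv I ν h, val_had]; rfl⟩
    | edge y z hyz e' h' =>
      have hy : y = x := hf (by simp [Factor.scope])
      have hz : z = x := hf (by simp [Factor.scope])
      exact absurd (hy.trans hz.symm) hyz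

theorem Factor.exists_simple_of_scope_eq_pair {x y : ℕ} (hxy : x ≠ y) (f : Factor S τ)
    (hf : f.scope = {x, y}) :
    ∃ e : Expr S (τ x) (τ y), IsSimple e ∧
      ∀ (I : Instance K S) (ν : ℕ → ℕ+), f.value I ν = val I e (ν x) (ν y) := by
  have hx : x ∈ f.scope := by simp [hf]
  have hy : y ∈ f.scope := by simp [hf]
  cases f with
  | scalar e h => simp [Factor.scope] at hx
  | vec z e h => exact absurd (hx.trans hy.symm) hxy
  | edge u v huv e h =>
    rcases hx with rfl | hx
    · rcases hy with rfl | hy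
      · exact absurd rfl hxy
      · obtain rfl : y = v := hy
        exact ⟨e, h, fun _ _ => rfl⟩
    · obtain rfl : x = v := hx
      rcases hy with rfl | hy
      · exact ⟨_, .transpose h, fun I ν => (val_transpose _ _ _ _).symm⟩
      · exact absurd (Eq.symm hy) hxy

theorem exists_simple_of_scope_eq_pair {x y : ℕ} (hxy : x ≠ y) (F : List (Factor S τ))
    (hne : F ≠ []) (hF : ∀ f ∈ F, f.scope = {x, y}) :
    ∃ e : Expr S (τ x) (τ y), IsSimple e ∧
      ∀ (I : Instance K S) (ν : ℕ → ℕ+), prodValue I F ν = val I e (ν x) (ν y) := by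
  induction F with
  | nil => exact absurd rfl hne
  | cons f F ih =>
    obtain ⟨e', h', hv'⟩ := Factor.exists_simple_of_scope_eq_pair (K := K) hxy f (hF f (by simp))
    by_cases hF' : F = []
    · exact ⟨e', h', fun I ν => by simp [prodValue, hF', hv']⟩
    · obtain ⟨e, he, hv⟩ := ih hF' fun g hg => hF g (by simp [hg])
      exact ⟨_, .had h' he, fun I ν => by rw [prodValue_cons, hv', hv, val_had]⟩

theorem Factor.scope_eq_pair {f : Factor S τ} {x y : ℕ} (hx : x ∈ f.scope) (hy : y ∈ f.scope)
    (hxy : x ≠ y) : f.scope = {x, y} := by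
  cases f with
  | scalar e h => exact absurd hx (by simp [Factor.scope])
  | vec z e h => exact absurd (hx.trans hy.symm) hxy
  | edge u v huv e h =>
    simp only [Factor.scope, Set.mem_insert_iff, Set.mem_singleton_iff] at hx hy ⊢
    rcases hx with rfl | rfl <;> rcases hy with rfl | rfl
    · exact absurd rfl hxy
    · rfl
    · exact Set.pair_comm _ _
    · exact absurd rfl hxy

/-! ### Elimination of bound variables -/

/-- A bound variable `z` all of whose factors mention with `z` every other variable of any of
these factors is summed out: either all factors of `z` mention `z` alone, and their sum is a
scalar, or all of them mention the same second variable `c`, and their sum is a vector over `c`.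
The q-hierarchical property is preserved. -/
theorem exists_eliminate {F : List (Factor S τ)} {B : Set ℕ} (hF : QHier (scopesOf F) B)
    {z : ℕ} (hz : ∀ f ∈ F, z ∈ f.scope → ∀ c ∈ f.scope, c ≠ z → Below (scopesOf F) z c) :
    ∃ F' : List (Factor S τ), QHier (scopesOf F') (B \ {z}) ∧
      (∀ f ∈ F', ∀ x ∈ f.scope, x ≠ z ∧ ∃ g ∈ F, x ∈ g.scope) ∧
      ∀ (I : Instance K S) (ν : ℕ → ℕ+),
        ∑ d ∈ Finset.Icc 1 (I.dim (τ z)), prodValue I F (Function.update ν z d) =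
          prodValue I F' ν := by
  obtain ⟨G, H, hG, hH, hp⟩ := exists_split (K := K) F z
  -- The new factor `N` has at most one variable, and its only variable shares a factor with `z`.
  suffices h : ∃ N : Factor S τ,
      (∀ c ∈ N.scope, N.scope = {c} ∧ ∃ f ∈ F, f.scope = {z, c} ∧ c ≠ z) ∧
      ∀ (I : Instance K S) (ν : ℕ → ℕ+), ∑ d ∈ Finset.Icc 1 (I.dim (τ z)),
        prodValue I G (Function.update ν z d) = N.value I ν by
    obtain ⟨N, hN, hNv⟩ := h
    refine ⟨N :: H, ?_, ?_, fun I ν => ?_⟩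
    · have key : ∀ s ∈ scopesOf F, z ∉ s → ∀ u ∈ s, ∀ v ∈ s, u ≠ v →
          ((v ∈ B → u ∈ B) ∧ Below (scopesOf F) u v) →
          ((v ∈ B \ {z} → u ∈ B \ {z}) ∧ Below (scopesOf (N :: H)) u v) := by
        rintro s hs hzs u hu v hv huv ⟨h₁, h₂⟩
        have huz : u ≠ z := fun h => hzs (h ▸ hu)
        refine ⟨fun h => ⟨h₁ h.1, huz⟩, ?_⟩
        rintro _ ⟨f, hf, rfl⟩ huf
        rcases List.mem_cons.1 hf with rfl | hf
        · obtain ⟨-, g, hg, hgs, -⟩ := hN u huf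
          have hvg := h₂ _ ⟨g, hg, rfl⟩ (by simp [hgs])
          rw [hgs] at hvg
          rcases hvg with rfl | hvg
          · exact absurd hv hzs
          · exact absurd hvg.symm huv
        · exact h₂ _ ⟨f, ((hH f).1 hf).1, rfl⟩ huf
      rintro _ ⟨f, hf, rfl⟩ u hu v hv huv
      rcases List.mem_cons.1 hf with rfl | hf
      · rw [(hN u hu).1] at hv
        exact absurd hv.symm huv
      · obtain ⟨hf, hzf⟩ := (hH f).1 hf
        refine (hF _ ⟨f, hf, rfl⟩ u hu v hv huv).imp ?_ ?_
        · exact key _ ⟨f, hf, rfl⟩ hzf u hu v hv huv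
        · exact key _ ⟨f, hf, rfl⟩ hzf v hv u hu huv.symm
    · intro f hf x hx
      rcases List.mem_cons.1 hf with rfl | hf
      · obtain ⟨-, g, hg, hgs, hne⟩ := hN x hx
        exact ⟨hne, g, hg, by simp [hgs]⟩
      · obtain ⟨hf, hzf⟩ := (hH f).1 hf
        exact ⟨fun h => hzf (h ▸ hx), f, hf, hx⟩
    · rw [prodValue_cons, ← hNv, Finset.sum_mul]
      refine Finset.sum_congr rfl fun d _ => ?_
      rw [hp, prodValue_update fun f hf => ((hH f).1 hf).2]
  by_cases hc : ∃ f ∈ G, ∃ c ∈ f.scope, c ≠ z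
  · obtain ⟨f, hf, c, hcf, hcz⟩ := hc
    have hfF := (hG f).1 hf
    have hall : ∀ g ∈ G, g.scope = {c, z} := by
      intro g hg
      obtain ⟨hg, hzg⟩ := (hG g).1 hg
      exact Factor.scope_eq_pair (hz f hfF.1 hfF.2 c hcf hcz _ ⟨g, hg, rfl⟩ hzg) hzg hcz
    obtain ⟨e, he, hv⟩ := exists_simple_of_scope_eq_pair (K := K) hcz G
      (List.ne_nil_of_mem hf) hall
    refine ⟨.vec c _ (.mulOnes he), ?_, fun I ν => ?_⟩
    · intro c' hc'
      obtain rfl : c' = c := hc'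
      exact ⟨rfl, f, hfF.1, by rw [hall f hf, Set.pair_comm], hcz⟩
    · simp [hv, hcz, Factor.value, val_mul_ones]
  · have hall : ∀ g ∈ G, g.scope ⊆ {z} := by
      intro g hg c hcg
      by_contra hcz
      exact hc ⟨g, hg, c, hcg, hcz⟩
    obtain ⟨e, he, hv⟩ := exists_simple_of_scope_subset_singleton (K := K) z G hall
    refine ⟨.scalar _ (.mulOnes (.transpose he)), ?_, fun I ν => ?_⟩
    · exact fun c hc => hc.elim
    · simp only [Factor.value, val_mul_ones, val_transpose]
      refine Finset.sum_congr rfl fun d hd => ?_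
      rw [hv I _ (by simpa using (Finset.mem_Icc.1 hd).2), Function.update_self]

/-- Bound variables are eliminated in an order in which the factors of each are minimal, so that
the leaves of a star of factors precede its centre. -/
theorem exists_eliminate_all (Y : List ℕ) (F : List (Factor S τ)) (hY : Y.Nodup)
    (hF : QHier (scopesOf F) {y | y ∈ Y}) :
    ∃ F' : List (Factor S τ), QHier (scopesOf F') ∅ ∧
      (∀ f ∈ F', ∀ x ∈ f.scope, x ∉ Y ∧ ∃ g ∈ F, x ∈ g.scope) ∧
      ∀ (I : Instance K S) (ν : ℕ → ℕ+),
        sumOver (fun x => I.dim (τ x)) Y (prodValue I F) ν = prodValue I F' ν := by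
  induction hn : Y.length generalizing Y F with
  | zero =>
    obtain rfl := List.length_eq_zero_iff.1 hn
    exact ⟨F, by simpa using hF, fun f hf x hx => ⟨by simp, f, hf, hx⟩, fun I ν => rfl⟩
  | succ n ih =>
    have hne : {y | y ∈ Y}.Nonempty := List.exists_mem_of_length_pos (by omega)
    obtain ⟨z, hzY, hmin⟩ := Set.Finite.exists_minimalFor
      (fun u => {s ∈ scopesOf F | u ∈ s}) _ Y.finite_toSet hne
    have hz : ∀ f ∈ F, z ∈ f.scope → ∀ c ∈ f.scope, c ≠ z → Below (scopesOf F) z c := by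
      intro f hf hzf c hcf hcz
      rcases hF _ ⟨f, hf, rfl⟩ z hzf c hcf hcz.symm with h | ⟨h₁, h₂⟩
      · exact h.2
      · exact fun s hs hzs => (hmin (h₁ hzY) (fun t ht => ⟨ht.1, h₂ t ht.1 ht.2⟩) ⟨hs, hzs⟩).2
    obtain ⟨F₁, hq₁, hs₁, hv₁⟩ := exists_eliminate (K := K) hF hz
    have hB : {y | y ∈ Y} \ {z} = {y | y ∈ Y.erase z} := by
      ext y
      simp [hY.mem_erase_iff, and_comm]
    rw [hB] at hq₁
    obtain ⟨F₂, hq₂, hs₂, hv₂⟩ := ih (Y.erase z) F₁ (hY.erase z) hq₁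
      (by rw [List.length_erase_of_mem hzY, hn]; rfl)
    refine ⟨F₂, hq₂, fun f hf x hx => ?_, fun I ν => ?_⟩
    · obtain ⟨h₁, g, hg, hxg⟩ := hs₂ f hf x hx
      obtain ⟨h₂, h₃⟩ := hs₁ g hg x hxg
      exact ⟨fun h => h₁ (hY.mem_erase_iff.2 ⟨h₂, h⟩), h₃⟩
    · have hperm : Y.Perm (Y.erase z ++ [z]) :=
        (List.perm_cons_erase hzY).trans (List.perm_append_singleton _ _).symm
      rw [sumOver_perm _ hperm, sumOver_append, ← hv₂]
      congr 1
      funext μ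
      exact hv₁ I μ

/-! ### Products over the head variables as qh-MATLANG expressions -/

/-- If some factors mention both head variables, then all factors of one of them, say `y`, mention
`x` too, so that the product is a matrix over `x` and `y` times a vector over `x`. -/
theorem exists_qh_of_scope_subset_pair {x y : ℕ} (hxy : x ≠ y) (F : List (Factor S τ))
    (hF : ∀ f ∈ F, f.scope ⊆ {x, y}) {B : Set ℕ} (hq : QHier (scopesOf F) B) :
    ∃ e : Expr S (τ x) (τ y), IsQH e ∧
      ∀ (I : Instance K S) (ν : ℕ → ℕ+), (∀ z, ν z ≤ I.dim (τ z)) →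
        prodValue I F ν = val I e (ν x) (ν y) := by
  by_cases h : ∃ f ∈ F, x ∈ f.scope ∧ y ∈ f.scope
  · obtain ⟨f, hf, hxf, hyf⟩ := h
    rcases hq _ ⟨f, hf, rfl⟩ x hxf y hyf hxy with ⟨-, h⟩ | ⟨-, h⟩
    · obtain ⟨G, H, hG, hH, hp⟩ := exists_split (K := K) F x
      obtain ⟨e₁, he₁, hv₁⟩ := exists_simple_of_scope_eq_pair (K := K) hxy G
        (List.ne_nil_of_mem ((hG f).2 ⟨hf, hxf⟩)) fun g hg => by
          obtain ⟨hg, hxg⟩ := (hG g).1 hg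
          exact Factor.scope_eq_pair hxg (h _ ⟨g, hg, rfl⟩ hxg) hxy
      obtain ⟨e₂, he₂, hv₂⟩ := exists_simple_of_scope_subset_singleton (K := K) y H
        fun g hg u hu => by
          obtain ⟨hg, hxg⟩ := (hH g).1 hg
          exact (hF g hg hu).resolve_left fun h => hxg (h ▸ hu)
      refine ⟨_, .rowHad (.transpose he₂) he₁, fun I ν hν => ?_⟩
      rw [hp, hv₁, hv₂ I ν (hν y), val_had, val_ones_mul I _ _ (hν x), val_transpose, mul_comm]
    · obtain ⟨G, H, hG, hH, hp⟩ := exists_split (K := K) F y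
      obtain ⟨e₁, he₁, hv₁⟩ := exists_simple_of_scope_eq_pair (K := K) hxy G
        (List.ne_nil_of_mem ((hG f).2 ⟨hf, hyf⟩)) fun g hg => by
          obtain ⟨hg, hyg⟩ := (hG g).1 hg
          exact Factor.scope_eq_pair (h _ ⟨g, hg, rfl⟩ hyg) hyg hxy
      obtain ⟨e₂, he₂, hv₂⟩ := exists_simple_of_scope_subset_singleton (K := K) x H
        fun g hg u hu => by
          obtain ⟨hg, hyg⟩ := (hH g).1 hg
          exact (hF g hg hu).resolve_right fun h => hyg (h ▸ hu)
      refine ⟨_, .hadCol he₁ he₂, fun I ν hν => ?_⟩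
      rw [hp, hv₁, hv₂ I ν (hν x), val_had, val_mul_transpose_ones I _ _ (hν y)]
  · obtain ⟨G, H, hG, hH, hp⟩ := exists_split (K := K) F y
    obtain ⟨e₁, he₁, hv₁⟩ := exists_simple_of_scope_subset_singleton (K := K) y G
      fun g hg u hu => by
        obtain ⟨hg, hyg⟩ := (hG g).1 hg
        exact (hF g hg hu).resolve_left fun hux => h ⟨g, hg, hux ▸ hu, hyg⟩
    obtain ⟨e₂, he₂, hv₂⟩ := exists_simple_of_scope_subset_singleton (K := K) x H
      fun g hg u hu => by
        obtain ⟨hg, hyg⟩ := (hH g).1 hg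
        exact (hF g hg hu).resolve_right fun h => hyg (h ▸ hu)
    refine ⟨_, .rowHadCol (.transpose he₁) he₂, fun I ν hν => ?_⟩
    rw [hp, hv₁ I ν (hν y), hv₂ I ν (hν x), val_had, val_mul_transpose_ones I _ _ (hν y),
      val_ones_mul I _ _ (hν x), val_transpose]

end Factors

/-! ### From conjunctive queries to qh-MATLANG -/

section ToMatlang

variable {K : Type*} [CommSemiring K] {S : Schema} {V : Vocab} {E : SchemaEncoding S V}

theorem exists_simple_eq_sym (A : S.Sym) {a b : S.Size} (ha : S.row A = a) (hb : S.col A = b) :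
    ∃ e : Expr S a b, IsSimple e ∧
      ∀ (I : Instance K S) p q, val I (.sym A) p q = val I e p q := by
  subst ha hb
  exact ⟨_, .sym A, fun _ _ _ => rfl⟩

/-- A relational atom is a factor over its variables of type other than `1`. -/
theorem exists_factor_of_rel (R : V.Rel) {xs : Fin (V.arity R) → ℕ} {τ : ℕ → S.Size}
    (ht : WellTyped E (.rel R xs) τ) :
    ∃ f : Factor S τ, f.scope = {x ∈ Set.range xs | τ x ≠ S.one} ∧
      ∀ (I : Instance K S) (db : Database K V), InstanceEncodes E I db →
        ∀ ν : ℕ → ℕ+, (∀ x, ν x ≤ I.dim (τ x)) → db.rel R (ν ∘ xs) = f.value I ν := by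
  cases ht with
  | rel _ _ _ ht =>
  obtain ⟨r, c, h₁, -, -, -, h₅, h₆⟩ := InstanceEncodes.exists_places (K := K) E R
  obtain ⟨hr, hc⟩ := (h₅ _).1 ht
  have val_one : ∀ (I : Instance K S) (ν : ℕ → ℕ+), (∀ x, ν x ≤ I.dim (τ x)) →
      ∀ x, τ x = S.one → ν x = 1 := by
    intro I ν hν x hx
    have := hν x
    rw [hx, I.dim_one] at this
    exact le_antisymm this one_le
  -- An argument of type `1` is treated like a missing one.
  have drop : ∀ p : Option (Fin (V.arity R)), ∃ q : Option ℕ, (∀ x, q = some x → τ x ≠ S.one) ∧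
      p.elim S.one (τ ∘ xs) = q.elim S.one τ ∧
      (∀ x, q = some x ↔ (∃ i, p = some i ∧ xs i = x) ∧ τ x ≠ S.one) ∧
      ∀ (I : Instance K S) (ν : ℕ → ℕ+), (∀ x, ν x ≤ I.dim (τ x)) →
        p.elim 1 (ν ∘ xs) = q.elim 1 ν := by
    rintro (_ | i)
    · exact ⟨none, by simp, rfl, by simp, fun _ _ _ => rfl⟩
    · by_cases h : τ (xs i) = S.one
      · refine ⟨none, by simp, by simp [h], ?_, fun I ν hν => by simp [val_one I ν hν _ h]⟩
        rintro x
        simp only [Option.some.injEq, exists_eq_left', false_iff, reduceCtorEq]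
        rintro ⟨rfl, h'⟩
        exact h' h
      · refine ⟨some (xs i), ?_, rfl, ?_, fun _ _ _ => rfl⟩
        · rintro x ⟨⟩
          exact h
        · intro x
          simp only [Option.some.injEq, exists_eq_left', iff_self_and]
          rintro rfl
          exact h
  obtain ⟨r', hr₁, hr₂, hr₃, hr₄⟩ := drop r
  obtain ⟨c', hc₁, hc₂, hc₃, hc₄⟩ := drop c
  have hscope : {x ∈ Set.range xs | τ x ≠ S.one} = {x | r' = some x ∨ c' = some x} := by
    ext x
    simp only [Set.mem_ofPred_eq, hr₃, hc₃, ← or_and_right, Set.mem_range]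
    refine and_congr_left fun _ => ⟨?_, ?_⟩
    · rintro ⟨i, rfl⟩
      exact (h₁ i).imp (fun h => ⟨i, h, rfl⟩) fun h => ⟨i, h, rfl⟩
    · rintro (⟨i, -, h⟩ | ⟨i, -, h⟩) <;> exact ⟨i, h⟩
  obtain ⟨e, he, hv⟩ := exists_simple_eq_sym (K := K) _ (hr.trans hr₂) (hc.trans hc₂)
  suffices h : ∃ f : Factor S τ, f.scope = {x | r' = some x ∨ c' = some x} ∧
      ∀ (I : Instance K S) (ν : ℕ → ℕ+), (∀ x, ν x ≤ I.dim (τ x)) →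
        f.value I ν = val I e (r'.elim 1 ν) (c'.elim 1 ν) by
    obtain ⟨f, hf, hfv⟩ := h
    refine ⟨f, hf.trans hscope.symm, fun I db hI ν hν => ?_⟩
    rw [h₆ I db hI, hv, hfv I ν hν, hr₄ I ν hν, hc₄ I ν hν]
  clear hscope hr₃ hc₃ hr₄ hc₄ hr₂ hc₂ hv
  rcases r' with _ | x <;> rcases c' with _ | y
  · exact ⟨.scalar e he, by simp [Factor.scope], fun _ _ _ => rfl⟩
  · exact ⟨.vec y _ he.transpose, by ext; simp [Factor.scope, eq_comm],
      fun I ν _ => val_transpose _ _ _ _⟩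
  · exact ⟨.vec x e he, by ext; simp [Factor.scope, eq_comm], fun _ _ _ => rfl⟩
  · by_cases hxy : x = y
    · subst hxy
      change Expr S (τ x) (τ x) at e
      -- The diagonal of a matrix as a vector.
      refine ⟨.vec x _ (.mulOnes (.had he (.ident (τ x)))), by ext; simp [Factor.scope, eq_comm],
        fun I ν hν => ?_⟩
      simp [Factor.value, val_mul_ones, val_had, val_ident, hν x]
    · exact ⟨.edge x y hxy e he, by ext; simp [Factor.scope, eq_comm], fun _ _ _ => rfl⟩

theorem Formula.scopes_and (φ₁ φ₂ : Formula V) :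
    (φ₁.and φ₂).scopes = φ₁.scopes ∪ φ₂.scopes :=
  Set.image_union _ _ _

theorem Formula.scopes_le (x : ℕ) (c : V.Const) : (Formula.le x c).scopes = ∅ :=
  Set.image_empty _

theorem Formula.scopes_rel (R : V.Rel) (xs : Fin (V.arity R) → ℕ) :
    (Formula.rel R xs).scopes = {Set.range xs} :=
  Set.image_singleton

/-- Over valuations in the ranges given by the types, a conjunction is a product of factors:
comparison atoms have the value `1`. -/
theorem exists_factors {φ : Formula V} (hφ : φ.IsConj) {τ : ℕ → S.Size}
    (ht : WellTyped E φ τ) :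
    ∃ F : List (Factor S τ), scopesOf F = (fun s => {x ∈ s | τ x ≠ S.one}) '' φ.scopes ∧
      ∀ (I : Instance K S) (db : Database K V), InstanceEncodes E I db →
        ∀ ν : ℕ → ℕ+, (∀ x, ν x ≤ I.dim (τ x)) → φ.eval db ν = prodValue I F ν := by
  induction hφ with
  | rel R xs =>
    obtain ⟨f, hf, hv⟩ := exists_factor_of_rel (K := K) R ht
    refine ⟨[f], ?_, fun I db hI ν hν => ?_⟩
    · rw [Formula.scopes_rel, Set.image_singleton, ← hf]
      ext s
      simp [scopesOf]
    · simp only [prodValue, List.map_cons, List.map_nil, List.prod_cons, List.prod_nil, mul_one]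
      exact hv I db hI ν hν
  | le x c =>
    cases ht with
    | le _ _ _ ht =>
      refine ⟨[], by simp [scopesOf, Formula.scopes_le], fun I db hI ν hν => ?_⟩
      rw [Formula.eval, hI.2, ← ht, if_pos (hν x)]
      rfl
  | and _ _ ih₁ ih₂ =>
    cases ht with
    | and ht₁ ht₂ =>
      obtain ⟨F₁, hs₁, hv₁⟩ := ih₁ ht₁
      obtain ⟨F₂, hs₂, hv₂⟩ := ih₂ ht₂
      refine ⟨F₁ ++ F₂, ?_, fun I db hI ν hν => ?_⟩
      · rw [Formula.scopes_and, Set.image_union, ← hs₁, ← hs₂]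
        ext s
        simp [scopesOf, or_and_right, exists_or]
      · rw [Formula.eval, hv₁ I db hI ν hν, hv₂ I db hI ν hν, prodValue_append]

theorem Formula.IsConj.subset_free {φ : Formula V} (hφ : φ.IsConj) :
    ∀ s ∈ φ.scopes, s ⊆ φ.free := by
  induction hφ with
  | rel R xs => simp [Formula.scopes_rel, Formula.free]
  | le x c => simp [Formula.scopes_le]
  | and _ _ ih₁ ih₂ =>
    rw [Formula.scopes_and]
    rintro s (hs | hs)
    · exact (ih₁ s hs).trans Set.subset_union_left
    · exact (ih₂ s hs).trans Set.subset_union_right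

/-- The output of a well-typed binary q-hierarchical query is a product of factors over its head
variables that is q-hierarchical itself. -/
theorem Query.exists_factors {k : ℕ} {Q : Query V k} (hp : Q.body.IsPrenex)
    (hq : Q.IsQHierarchical) {τ : ℕ → S.Size} (ht : WellTyped E Q.body τ) :
    ∃ (τ' : ℕ → S.Size) (F : List (Factor S τ')), τ ∘ Q.head = τ' ∘ Q.head ∧
      QHier (scopesOf F) ∅ ∧ (∀ f ∈ F, f.scope ⊆ Set.range Q.head) ∧
      ∀ (I : Instance K S) (db : Database K V), InstanceEncodes E I db → ∀ ν : ℕ → ℕ+,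
        ((∀ x, ν x ≤ I.dim (τ' x)) → Q.body.eval db ν = prodValue I F ν) ∧
        ∀ i, ¬ ν (Q.head i) ≤ I.dim (τ' (Q.head i)) → Q.body.eval db ν = 0 := by
  obtain ⟨φ, Y, τ', h₁, h₂, h₃, h₄, h₅, h₆, h₇, h₈⟩ := hp.exists_exs K ht
  obtain ⟨F, hs, hv⟩ := QHMatlang.exists_factors (K := K) h₁ h₂
  have hscopes : Q.body.scopes = φ.scopes := by rw [Formula.scopes, h₆]; rfl
  have hfree : ∀ x ∈ φ.free, (x ∉ Set.range Q.head ↔ x ∈ Y) := by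
    intro x hx
    rw [Q.head_free, h₅]
    simp [hx]
  have hq' : QHier (scopesOf F) {y | y ∈ Y} := by
    rw [isQHierarchical_iff, hscopes] at hq
    rw [hs]
    have below : ∀ u v, τ' v ≠ S.one → Below φ.scopes u v →
        Below ((fun s => {x ∈ s | τ' x ≠ S.one}) '' φ.scopes) u v := by
      rintro u v hv h _ ⟨s, hs, rfl⟩ hu
      exact ⟨h s hs hu.1, hv⟩
    rintro _ ⟨s, hs, rfl⟩ u ⟨hu, hu'⟩ v ⟨hv, hv'⟩ huv
    have hus := hfree u (h₁.subset_free s hs hu)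
    have hvs := hfree v (h₁.subset_free s hs hv)
    simp only [Set.mem_ofPred_eq, ← hus, ← hvs]
    exact (hq s hs u hu v hv huv).imp (And.imp_right (below u v hv'))
      (And.imp_right (below v u hu'))
  obtain ⟨F', hq₁, hs₁, hv₁⟩ := exists_eliminate_all (K := K) Y F h₃ hq'
  refine ⟨τ', F', ?_, hq₁, ?_, fun I db hI ν => ⟨fun hν => ?_, fun i hi => ?_⟩⟩
  · funext i
    exact h₇ _ (Q.head_free ▸ ⟨i, rfl⟩)
  · intro f hf x hx
    obtain ⟨hxY, g, hg, hxg⟩ := hs₁ f hf x hx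
    have hgs : g.scope ∈ scopesOf F := ⟨g, hg, rfl⟩
    rw [hs] at hgs
    obtain ⟨s, hs', hgs⟩ := hgs
    rw [← hgs] at hxg
    by_contra h
    exact hxY ((hfree x (h₁.subset_free s hs' hxg.1)).1 h)
  · rw [h₈, eval_exs hI h₁ h₂ h₃ h₄, ← hv₁]
    exact sumOver_congr Y hν fun μ hμ => hv I db hI μ hμ
  · have hi' : Q.head i ∈ φ.free \ {n | n ∈ Y} := by
      rw [← h₅, ← Q.head_free]
      exact ⟨i, rfl⟩
    rw [h₈, eval_exs hI h₁ h₂ h₃ h₄]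
    refine sumOver_eq_zero _ hi'.2 fun μ hμ => ?_
    by_contra h0
    refine hi ?_
    rw [← hμ]
    exact le_dim_of_eval_ne_zero hI h₁ h₂ h0 _ hi'.1

theorem exists_qh_of_query {k : ℕ} {Q : Query V k} (hQ : Q.IsBinaryQHCQ) {a b : S.Size}
    (hk : ArityFits S a b k) (ht : Q.IsWellTyped E a b) :
    ∃ e : Expr S a b, IsQH e ∧ Simulates K E e Q := by
  obtain ⟨hp, -, hq⟩ := hQ
  obtain ⟨τ₀, ht, ha⟩ := ht
  obtain ⟨τ, F, hτ, hF, hs, hv⟩ := Query.exists_factors (K := K) hp hq ht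
  obtain ⟨r, c, h₁, h₂, -, -, h₅, h₆⟩ := hk.exists_places K
  obtain ⟨hr, hc⟩ := (h₅ _).1 ha
  rw [hτ] at hr hc
  suffices h : ∃ e : Expr S a b, IsQH e ∧
      (∀ (I : Instance K S) (ν : ℕ → ℕ+), (∀ x, ν x ≤ I.dim (τ x)) →
        val I e (r.elim 1 (ν ∘ Q.head)) (c.elim 1 (ν ∘ Q.head)) = prodValue I F ν) ∧
      ∀ (I : Instance K S) d i j, Q.head i = Q.head j → d i ≠ d j →
        val I e (r.elim 1 d) (c.elim 1 d) = 0 by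
    obtain ⟨e, he, hev, he0⟩ := h
    refine ⟨e, he, fun I db hI => (h₆ I _ _).2 fun d => ?_⟩
    change _ = val I e _ _
    rw [Query.output]
    split_ifs with hd
    · set ν := Function.extend Q.head d fun _ => 1 with hνdef
      have hνd : ν ∘ Q.head = d := by
        funext i
        exact Function.FactorsThrough.extend_apply (fun i j h => hd i j h) (fun _ => 1) i
      obtain ⟨hv₁, hv₂⟩ := hv I db hI ν
      by_cases hle : ∀ i, ν (Q.head i) ≤ I.dim (τ (Q.head i))
      · have hν : ∀ x, ν x ≤ I.dim (τ x) := by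
          intro x
          by_cases hx : ∃ i, Q.head i = x
          · obtain ⟨i, rfl⟩ := hx
            exact hle i
          · rw [hνdef, Function.extend_apply' _ _ _ hx]
            exact one_le
        rw [hv₁ hν, ← hev I ν hν, hνd]
      · obtain ⟨i, hi⟩ := not_forall.1 hle
        rw [hv₂ i hi]
        have hdi : ν (Q.head i) = d i := congrFun hνd i
        rw [hdi] at hi
        rcases h₁ i with rfl | rfl
        · exact (val_eq_zero_of_row I (by rw [hr]; exact hi) _ _).symm
        · exact (val_eq_zero_of_col I (by rw [hc]; exact hi) _ _).symm
    · push Not at hd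
      obtain ⟨i, j, hij, hd⟩ := hd
      exact (he0 I d i j hij hd).symm
  subst hr hc
  rcases r with _ | i <;> rcases c with _ | j
  · obtain ⟨e, he, hev⟩ := exists_simple_of_scope_eq_empty (K := K) F fun f hf =>
      Set.eq_empty_of_forall_notMem fun x hx => by
        obtain ⟨i, -⟩ := hs f hf hx
        simpa using h₁ i
    refine ⟨e, .simple he, fun I ν _ => (hev I ν).symm, fun I d i => ?_⟩
    simpa using h₁ i
  · have hj : ∀ i, i = j := fun i => by simpa [eq_comm] using h₁ i
    obtain ⟨e, he, hev⟩ := exists_simple_of_scope_subset_singleton (K := K) (Q.head j) F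
      fun f hf x hx => by
        obtain ⟨i, rfl⟩ := hs f hf hx
        rw [hj i]
        rfl
    refine ⟨e.transpose, .simple he.transpose, fun I ν hν => ?_, fun I d i i' _ h => ?_⟩
    · rw [hev I ν (hν _)]
      exact val_transpose I e _ _
    · rw [hj i, hj i'] at h
      exact absurd rfl h
  · have hi : ∀ j, j = i := fun j => by simpa [eq_comm] using h₁ j
    obtain ⟨e, he, hev⟩ := exists_simple_of_scope_subset_singleton (K := K) (Q.head i) F
      fun f hf x hx => by
        obtain ⟨j, rfl⟩ := hs f hf hx
        rw [hi j]
        rfl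
    refine ⟨e, .simple he, fun I ν hν => ?_, fun I d j j' _ h => ?_⟩
    · rw [hev I ν (hν _)]
      rfl
    · rw [hi j, hi j'] at h
      exact absurd rfl h
  · have hij : ∀ l, l = i ∨ l = j := fun l => by simpa [eq_comm] using h₁ l
    by_cases hx : Q.head i = Q.head j
    · -- Both head variables are the same: the output is a diagonal matrix.
      obtain ⟨e, he, hev⟩ := exists_simple_of_scope_subset_singleton (K := K) (Q.head i) F
        fun f hf x hx' => by
          obtain ⟨l, rfl⟩ := hs f hf hx'
          rcases hij l with rfl | rfl
          · rfl
          · exact hx.symm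
      have hid : ∃ e' : Expr S (τ (Q.head i)) (τ (Q.head j)), IsSimple e' ∧
          ∀ (I : Instance K S) p q, val I e' p q =
            if p = q then (if p ≤ I.dim (τ (Q.head i)) then 1 else 0) else 0 := by
        rw [← hx]
        exact ⟨_, .ident _, fun I => val_ident I⟩
      obtain ⟨e', he', hev'⟩ := hid
      refine ⟨_, .hadCol he' he, fun I ν hν => ?_, fun I d l l' _ hd => ?_⟩
      · simp only [Option.elim, Function.comp_apply]
        rw [val_had, val_mul_transpose_ones I _ _ (hν _), hev', if_pos (by rw [hx]),
          if_pos (hν _), one_mul, hev I ν (hν _)]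
      · simp only [Option.elim]
        rw [val_had, hev', if_neg, zero_mul]
        rcases hij l with rfl | rfl <;> rcases hij l' with rfl | rfl
        · exact absurd rfl hd
        · exact hd
        · exact hd.symm
        · exact absurd rfl hd
    · obtain ⟨e, he, hev⟩ := exists_qh_of_scope_subset_pair (K := K) hx F
        (fun f hf x hx' => by
          obtain ⟨l, rfl⟩ := hs f hf hx'
          rcases hij l with rfl | rfl <;> simp) hF
      refine ⟨e, he, fun I ν hν => (hev I ν hν).symm, fun I d l l' h hd => ?_⟩
      rcases hij l with rfl | rfl <;> rcases hij l' with rfl | rfl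
      · exact absurd rfl hd
      · exact absurd h hx
      · exact absurd h.symm hx
      · exact absurd rfl hd

end ToMatlang

/-! ### Renaming of variables in conjunctions -/

section Rename

variable {K : Type*} [CommSemiring K] {S : Schema} {V : Vocab} {E : SchemaEncoding S V}

/-- Renaming of all variables, free and bound. -/
def Formula.rename (ρ : ℕ → ℕ) : Formula V → Formula V
  | .rel R xs => .rel R (ρ ∘ xs)
  | .le x c => .le (ρ x) c
  | .and φ₁ φ₂ => .and (φ₁.rename ρ) (φ₂.rename ρ)
  | .ex y φ => .ex (ρ y) (φ.rename ρ)

theorem Formula.IsConj.rename {φ : Formula V} (h : φ.IsConj) (ρ : ℕ → ℕ) :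
    (φ.rename ρ).IsConj := by
  induction h with
  | rel R xs => exact .rel _ _
  | le x c => exact .le _ _
  | and _ _ ih₁ ih₂ => exact .and ih₁ ih₂

theorem Formula.IsConj.free_rename {φ : Formula V} (h : φ.IsConj) (ρ : ℕ → ℕ) :
    (φ.rename ρ).free = ρ '' φ.free := by
  induction h with
  | rel R xs => exact Set.range_comp _ _
  | le x c => exact Set.image_singleton.symm
  | and _ _ ih₁ ih₂ => simp only [Formula.rename, Formula.free, ih₁, ih₂, Set.image_union]

theorem Formula.IsConj.scopes_rename {φ : Formula V} (h : φ.IsConj) (ρ : ℕ → ℕ) :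
    (φ.rename ρ).scopes = (ρ '' ·) '' φ.scopes := by
  induction h with
  | rel R xs =>
    simp only [Formula.rename, Formula.scopes_rel, Set.image_singleton, Set.range_comp]
  | le x c => simp only [Formula.rename, Formula.scopes_le, Set.image_empty]
  | and _ _ ih₁ ih₂ =>
    simp only [Formula.rename, Formula.scopes_and, ih₁, ih₂, Set.image_union]

theorem Formula.IsConj.eval_rename {φ : Formula V} (h : φ.IsConj) (ρ : ℕ → ℕ)
    (db : Database K V) (ν : ℕ → ℕ+) : (φ.rename ρ).eval db ν = φ.eval db (ν ∘ ρ) := by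
  induction h with
  | rel R xs => rfl
  | le x c => rfl
  | and _ _ ih₁ ih₂ => simp only [Formula.rename, Formula.eval, ih₁, ih₂]

theorem Formula.IsConj.eval_update {φ : Formula V} (h : φ.IsConj) (db : Database K V)
    {x : ℕ} (hx : x ∉ φ.free) (ν : ℕ → ℕ+) (d : ℕ+) :
    φ.eval db (Function.update ν x d) = φ.eval db ν := by
  induction h with
  | rel R xs =>
    rw [Formula.eval, Function.update_comp_eq_of_forall_ne _ _ fun i h => hx ⟨i, h⟩]
    rfl
  | le y c =>
    have hxy : y ≠ x := fun h => hx h.symm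
    simp only [Formula.eval, Function.update_of_ne hxy]
  | and _ _ ih₁ ih₂ =>
    simp only [Formula.free, Set.mem_union, not_or] at hx
    simp only [Formula.eval, ih₁ hx.1, ih₂ hx.2]

theorem WellTyped.rename {φ : Formula V} (h : φ.IsConj) {τ : ℕ → S.Size}
    (ht : WellTyped E φ τ) {ρ : ℕ → ℕ} {τ' : ℕ → S.Size} (hτ : ∀ x ∈ φ.free, τ' (ρ x) = τ x) :
    WellTyped E (φ.rename ρ) τ' := by
  induction h with
  | rel R xs =>
    cases ht with
    | rel _ _ _ ht =>
      refine .rel _ _ _ ?_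
      rwa [show τ' ∘ ρ ∘ xs = τ ∘ xs from funext fun i => hτ _ ⟨i, rfl⟩]
  | le x c =>
    cases ht with
    | le _ _ _ ht => exact .le _ _ _ ((hτ x rfl).trans ht)
  | and _ _ ih₁ ih₂ =>
    cases ht with
    | and ht₁ ht₂ =>
      exact .and (ih₁ ht₁ fun x hx => hτ x (Or.inl hx)) (ih₂ ht₂ fun x hx => hτ x (Or.inr hx))

theorem sumOver_update {D : ℕ → ℕ+} {Y : List ℕ} {f : (ℕ → ℕ+) → K} {x : ℕ}
    (hx : x ∉ Y) (hf : ∀ ν d, f (Function.update ν x d) = f ν) (ν : ℕ → ℕ+) (d : ℕ+) :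
    sumOver D Y f (Function.update ν x d) = sumOver D Y f ν := by
  induction Y generalizing ν with
  | nil => exact hf ν d
  | cons y Y ih =>
    simp only [List.mem_cons, not_or] at hx
    simp only [sumOver]
    refine Finset.sum_congr rfl fun d' _ => ?_
    rw [Function.update_comm hx.1, ih hx.2]

end Rename

/-! ### Functions of two head variables that are presented by conjunctions -/

section Presentations

variable {K : Type*} [CommSemiring K] {S : Schema} {V : Vocab} {E : SchemaEncoding S V}

/-- The q-hierarchical property for the variables `0` and `1` as head variables and all others as
bound variables, without the requirement that `0` and `1` be comparable. -/
def HierAbove (𝒮 : Set (Set ℕ)) : Prop :=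
  ∀ s ∈ 𝒮, ∀ u ∈ s, ∀ v ∈ s, u ≠ v →
    (2 ≤ u ∧ Below 𝒮 u v) ∨ (2 ≤ v ∧ Below 𝒮 v u) ∨ (u < 2 ∧ v < 2)

/-- The conjunction `φ` of atoms, typed by `τ`, with the list `Y` of bound variables, defines the
function `f` of the head variables `0` and `1`, which have the types `t 0` and `t 1`. The family
`𝒯` restricts the sets of head variables that an atom may mention. -/
structure IsPresentation (E : SchemaEncoding S V) (t : ℕ → S.Size) (𝒯 : Set (Set ℕ))
    (f : Instance K S → ℕ+ → ℕ+ → K) (φ : Formula V) (τ : ℕ → S.Size) (Y : List ℕ) : Prop where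
  conj : φ.IsConj
  typed : WellTyped E φ τ
  head_type : ∀ n < 2, τ n = t n
  head_mem : ∀ n ∈ φ.free, n < 2 → ∃ T ∈ 𝒯, n ∈ T
  touch : ∀ s ∈ φ.scopes, ∃ T ∈ 𝒯, ∀ n < 2, n ∈ s ↔ n ∈ T
  hier : HierAbove φ.scopes
  nodup : Y.Nodup
  mem : ∀ n, n ∈ Y ↔ n ∈ φ.free ∧ 2 ≤ n
  value : ∀ (I : Instance K S) (db : Database K V), InstanceEncodes E I db → ∀ ν : ℕ → ℕ+,
    f I (ν 0) (ν 1) = sumOver (fun x => I.dim (τ x)) Y (φ.eval db) ν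

/-- The function `f` of the head variables `0` and `1` is defined by some conjunction. -/
def Presentable (E : SchemaEncoding S V) (t : ℕ → S.Size) (𝒯 : Set (Set ℕ))
    (f : Instance K S → ℕ+ → ℕ+ → K) : Prop :=
  ∃ φ τ Y, IsPresentation E t 𝒯 f φ τ Y

variable {t t' : ℕ → S.Size} {𝒯 𝒯' 𝒯₁ 𝒯₂ : Set (Set ℕ)}
  {f f' f₁ f₂ : Instance K S → ℕ+ → ℕ+ → K}
  {φ φ₁ φ₂ : Formula V} {τ τ' : ℕ → S.Size} {Y Y₁ Y₂ : List ℕ}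

theorem IsPresentation.rename (h : IsPresentation E t 𝒯 f φ τ Y) {ρ : ℕ → ℕ}
    (hρ : ∀ n m, 2 ≤ m → ρ n = ρ m → n = m) (hρ₂ : ∀ n, ρ n < 2 ↔ n < 2)
    (ht : ∀ n < 2, τ' n = t' n) (hτ : ∀ n ∈ φ.free, τ' (ρ n) = τ n)
    (h𝒯 : ∀ T ∈ 𝒯, ∃ T' ∈ 𝒯', ∀ n < 2, n ∈ T' ↔ ∃ m < 2, m ∈ T ∧ ρ m = n)
    (hf : ∀ I (ν : ℕ → ℕ+), f' I (ν 0) (ν 1) = f I (ν (ρ 0)) (ν (ρ 1))) :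
    IsPresentation E t' 𝒯' f' (φ.rename ρ) τ' (Y.map ρ) where
  conj := h.conj.rename ρ
  typed := h.typed.rename h.conj hτ
  head_type := ht
  head_mem := by
    rw [h.conj.free_rename]
    rintro _ ⟨n, hn, rfl⟩ hn₂
    have hn₂' := (hρ₂ n).1 hn₂
    obtain ⟨T, hT, hnT⟩ := h.head_mem n hn hn₂'
    obtain ⟨T', hT', hh⟩ := h𝒯 T hT
    exact ⟨T', hT', (hh _ hn₂).2 ⟨n, hn₂', hnT, rfl⟩⟩
  touch := by
    rw [h.conj.scopes_rename]
    rintro _ ⟨s, hs, rfl⟩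
    obtain ⟨T, hT, hsT⟩ := h.touch s hs
    obtain ⟨T', hT', hh⟩ := h𝒯 T hT
    refine ⟨T', hT', fun n hn => ?_⟩
    rw [hh n hn]
    constructor
    · rintro ⟨m, hm, rfl⟩
      have hm₂ := (hρ₂ m).1 hn
      exact ⟨m, hm₂, (hsT m hm₂).1 hm, rfl⟩
    · rintro ⟨m, hm, hmT, rfl⟩
      exact ⟨m, (hsT m hm).2 hmT, rfl⟩
  hier := by
    rw [h.conj.scopes_rename]
    have below : ∀ u v, 2 ≤ u ∧ Below φ.scopes u v →
        2 ≤ ρ u ∧ Below ((ρ '' ·) '' φ.scopes) (ρ u) (ρ v) := by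
      rintro u v ⟨hu, huv⟩
      refine ⟨not_lt.1 fun h => absurd ((hρ₂ u).1 h) (not_lt.2 hu), ?_⟩
      rintro _ ⟨s, hs, rfl⟩ ⟨n, hn, hnu⟩
      obtain rfl := hρ n u hu hnu
      exact ⟨v, huv s hs hn, rfl⟩
    rintro _ ⟨s, hs, rfl⟩ _ ⟨u, hu, rfl⟩ _ ⟨v, hv, rfl⟩ huv
    refine (h.hier s hs u hu v hv fun h => huv (h ▸ rfl)).imp (below u v) (Or.imp (below v u) ?_)
    exact And.imp (hρ₂ u).2 (hρ₂ v).2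
  nodup := by
    refine h.nodup.map_on fun x hx y hy hxy => ?_
    exact hρ x y ((h.mem y).1 hy).2 hxy
  mem := by
    intro n
    rw [h.conj.free_rename]
    simp only [List.mem_map, h.mem]
    constructor
    · rintro ⟨m, ⟨hm, hm₂⟩, rfl⟩
      exact ⟨⟨m, hm, rfl⟩, not_lt.1 fun h => absurd ((hρ₂ m).1 h) (not_lt.2 hm₂)⟩
    · rintro ⟨⟨m, hm, rfl⟩, hm₂⟩
      exact ⟨m, ⟨hm, not_lt.1 fun h => absurd ((hρ₂ m).2 h) (not_lt.2 hm₂)⟩, rfl⟩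
  value := by
    intro I db hI ν
    rw [hf, show (φ.rename ρ).eval db = fun μ => φ.eval db (μ ∘ ρ) from
      funext fun μ => h.conj.eval_rename ρ db μ,
      sumOver_map _ fun y hy n hn => hρ n y ((h.mem y).1 hy).2 hn,
      sumOver_congr_bound (D' := fun x => I.dim (τ x)) _ fun y hy => by
        simp [hτ y ((h.mem y).1 hy).1]]
    exact h.value I db hI (ν ∘ ρ)

/-- Changes of the types of the head variables that do not occur, and of the family `𝒯`. -/
theorem Presentable.congr (h : Presentable E t 𝒯 f)
    (h𝒯 : ∀ T ∈ 𝒯, ∃ T' ∈ 𝒯', ∀ n < 2, n ∈ T ↔ n ∈ T')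
    (ht : ∀ T ∈ 𝒯, ∀ n < 2, n ∈ T → t n = t' n) (hf : ∀ I p q, f I p q = f' I p q) :
    Presentable E t' 𝒯' f' := by
  obtain ⟨φ, τ, Y, h⟩ := h
  refine ⟨_, fun n => if n < 2 then t' n else τ n, _, h.rename (ρ := id)
    (fun _ _ _ h => h) (fun _ => Iff.rfl) (fun n hn => if_pos hn) (fun n hn => ?_)
    (fun T hT => ?_) (fun I ν => (hf _ _ _).symm)⟩
  · simp only [id]
    split_ifs with hn₂
    · obtain ⟨T, hT, hnT⟩ := h.head_mem n hn hn₂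
      rw [h.head_type n hn₂, ht T hT n hn₂ hnT]
    · rfl
  · obtain ⟨T', hT', hh⟩ := h𝒯 T hT
    refine ⟨T', hT', fun n hn => ?_⟩
    rw [← hh n hn]
    exact ⟨fun h => ⟨n, hn, h, rfl⟩, fun ⟨m, _, h, e⟩ => e ▸ h⟩

theorem IsPresentation.and (h₁ : IsPresentation E t 𝒯₁ f₁ φ₁ τ Y₁)
    (h₂ : IsPresentation E t 𝒯₂ f₂ φ₂ τ Y₂) (hd : ∀ n ∈ φ₁.free, n ∈ φ₂.free → n < 2) :
    IsPresentation E t (𝒯₁ ∪ 𝒯₂) (fun I p q => f₁ I p q * f₂ I p q) (φ₁.and φ₂) τ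
      (Y₁ ++ Y₂) where
  conj := .and h₁.conj h₂.conj
  typed := .and h₁.typed h₂.typed
  head_type := h₁.head_type
  head_mem := by
    rintro n (hn | hn) hn₂
    · obtain ⟨T, hT, h⟩ := h₁.head_mem n hn hn₂
      exact ⟨T, Or.inl hT, h⟩
    · obtain ⟨T, hT, h⟩ := h₂.head_mem n hn hn₂
      exact ⟨T, Or.inr hT, h⟩
  touch := by
    rw [Formula.scopes_and]
    rintro s (hs | hs)
    · obtain ⟨T, hT, h⟩ := h₁.touch s hs
      exact ⟨T, Or.inl hT, h⟩
    · obtain ⟨T, hT, h⟩ := h₂.touch s hs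
      exact ⟨T, Or.inr hT, h⟩
  hier := by
    rw [Formula.scopes_and]
    rintro s (hs | hs) u hu v hv huv
    · have below : ∀ u v, u ∈ s → 2 ≤ u ∧ Below φ₁.scopes u v →
          2 ≤ u ∧ Below (φ₁.scopes ∪ φ₂.scopes) u v := by
        rintro u v hu ⟨hu₂, huv⟩
        refine ⟨hu₂, ?_⟩
        rintro s' (hs' | hs') hus'
        · exact huv s' hs' hus'
        · exact absurd (hd u (h₁.conj.subset_free s hs hu) (h₂.conj.subset_free s' hs' hus'))
            (not_lt.2 hu₂)
      exact (h₁.hier s hs u hu v hv huv).imp (below u v hu) (Or.imp_left (below v u hv))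
    · have below : ∀ u v, u ∈ s → 2 ≤ u ∧ Below φ₂.scopes u v →
          2 ≤ u ∧ Below (φ₁.scopes ∪ φ₂.scopes) u v := by
        rintro u v hu ⟨hu₂, huv⟩
        refine ⟨hu₂, ?_⟩
        rintro s' (hs' | hs') hus'
        · exact absurd (hd u (h₁.conj.subset_free s' hs' hus') (h₂.conj.subset_free s hs hu))
            (not_lt.2 hu₂)
        · exact huv s' hs' hus'
      exact (h₂.hier s hs u hu v hv huv).imp (below u v hu) (Or.imp_left (below v u hv))
  nodup := by
    refine h₁.nodup.append h₂.nodup fun n hn₁ hn₂ => ?_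
    rw [h₁.mem] at hn₁
    rw [h₂.mem] at hn₂
    exact absurd (hd n hn₁.1 hn₂.1) (not_lt.2 hn₁.2)
  mem := by
    intro n
    simp only [List.mem_append, h₁.mem, h₂.mem, Formula.free, Set.mem_union]
    tauto
  value := by
    intro I db hI ν
    have hne : ∀ y ∈ Y₁, y ∉ φ₂.free := fun y hy h =>
      absurd (hd y ((h₁.mem y).1 hy).1 h) (not_lt.2 ((h₁.mem y).1 hy).2)
    have hne' : ∀ y ∈ Y₂, y ∉ φ₁.free := fun y hy h =>
      absurd (hd y h ((h₂.mem y).1 hy).1) (not_lt.2 ((h₂.mem y).1 hy).2)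
    rw [sumOver_append, h₁.value I db hI, h₂.value I db hI, mul_comm,
      ← sumOver_mul_left _ fun y hy μ d => sumOver_update
        (fun h => hne y hy ((h₂.mem y).1 h).1) (h₂.conj.eval_update db (hne y hy)) μ d]
    congr 1
    funext μ
    rw [mul_comm]
    exact (sumOver_mul_left _ (fun y hy => h₁.conj.eval_update db (hne' y hy)) _ _).symm

/-- Products: the bound variables of the two conjunctions are renamed apart. -/
theorem Presentable.mul (h₁ : Presentable E t 𝒯₁ f₁) (h₂ : Presentable E t 𝒯₂ f₂) :
    Presentable E t (𝒯₁ ∪ 𝒯₂) (fun I p q => f₁ I p q * f₂ I p q) := by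
  obtain ⟨φ₁, τ₁, Y₁, h₁⟩ := h₁
  obtain ⟨φ₂, τ₂, Y₂, h₂⟩ := h₂
  set τ : ℕ → S.Size := fun n =>
    if n < 2 then t n else if n % 2 = 0 then τ₁ (n / 2) else τ₂ (n / 2) with hτ
  have same : ∀ T : Set ℕ, ∀ ρ : ℕ → ℕ, (∀ n < 2, ρ n = n) →
      ∀ n < 2, n ∈ T ↔ ∃ m < 2, m ∈ T ∧ ρ m = n := by
    intro T ρ hρ n hn
    constructor
    · exact fun h => ⟨n, hn, h, hρ n hn⟩
    · rintro ⟨m, hm, h, rfl⟩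
      rwa [hρ m hm]
  refine ⟨_, τ, _, IsPresentation.and
    (h₁.rename (𝒯' := 𝒯₁) (ρ := fun n => if n < 2 then n else 2 * n) ?_ ?_ ?_ ?_ ?_ ?_)
    (h₂.rename (𝒯' := 𝒯₂) (ρ := fun n => if n < 2 then n else 2 * n + 1) ?_ ?_ ?_ ?_ ?_ ?_) ?_⟩
  · intro n m hm h
    split_ifs at h <;> omega
  · intro n
    split_ifs <;> omega
  · exact fun n hn => if_pos hn
  · intro n _
    by_cases hn : n < 2
    · simp only [hτ, hn, if_true, h₁.head_type n hn]
    · have h4 : ¬ 2 * n < 2 := by omega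
      have h5 : 2 * n % 2 = 0 := by omega
      have h6 : 2 * n / 2 = n := by omega
      simp only [hτ, hn, h4, h5, h6, if_true, if_false]
  · exact fun T hT => ⟨T, hT, same T _ fun n hn => if_pos hn⟩
  · exact fun I ν => rfl
  · intro n m hm h
    split_ifs at h <;> omega
  · intro n
    split_ifs <;> omega
  · exact fun n hn => if_pos hn
  · intro n _
    by_cases hn : n < 2
    · simp only [hτ, hn, if_true, h₂.head_type n hn]
    · have h4 : ¬ 2 * n + 1 < 2 := by omega
      have h5 : (2 * n + 1) % 2 = 1 := by omega
      have h6 : (2 * n + 1) / 2 = n := by omega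
      simp only [hτ, hn, h4, h5, h6, if_false, one_ne_zero]
  · exact fun T hT => ⟨T, hT, same T _ fun n hn => if_pos hn⟩
  · exact fun I ν => rfl
  · rw [h₁.conj.free_rename, h₂.conj.free_rename]
    rintro _ ⟨n, -, rfl⟩ ⟨m, -, h⟩
    dsimp only at h ⊢
    split_ifs at h ⊢ <;> omega

/-- Summation over the head variable `1`, which becomes the bound variable `2`. All atoms that
mention `1` mention the same head variables, so that they are atoms of `0` if one of them is. -/
theorem Presentable.sum {T : Set ℕ} (h : Presentable E t {∅, T} f) (hT : 1 ∈ T) :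
    Presentable E t {∅, T \ {1}} fun I p _ =>
      ∑ d ∈ Finset.Icc 1 (I.dim (t 1)), f I p d := by
  obtain ⟨φ, τ, Y, h⟩ := h
  -- The comparison makes sure that the new bound variable occurs.
  set φ' : Formula V := φ.and (.le 1 (E.const (t 1))) with hφ'
  have hc : φ'.IsConj := .and h.conj (.le _ _)
  have hsc : φ'.scopes = φ.scopes := by simp [hφ', Formula.scopes_and, Formula.scopes_le]
  set ρ : ℕ → ℕ := fun n => if n = 0 then 0 else n + 1 with hρ
  have hinj : ∀ n m, ρ n = ρ m → n = m := by
    intro n m h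
    simp only [hρ] at h
    split_ifs at h <;> omega
  have hρ0 : ρ 0 = 0 := rfl
  have hρ1 : ρ 1 = 2 := rfl
  have hρ2 : ∀ n, 2 ≤ ρ n ↔ n ≠ 0 := by
    intro n
    simp only [hρ]
    split_ifs <;> omega
  have h1Y : 1 ∉ Y := fun h1 => absurd ((h.mem 1).1 h1).2 (by norm_num)
  set τ' : ℕ → S.Size := fun n => if n < 2 then t n else τ (n - 1) with hτ'
  have hτρ : ∀ n, τ' (ρ n) = τ n := by
    rintro (_ | n)
    · simp [hτ', hρ, h.head_type]
    · simp [hτ', hρ]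
  have hfree : φ'.free = insert 1 φ.free := by
    rw [Set.insert_eq, Set.union_comm]
    rfl
  refine ⟨φ'.rename ρ, τ', 2 :: Y.map ρ, ⟨hc.rename ρ, ?_, fun n hn => if_pos hn, ?_, ?_, ?_,
    ?_, ?_, ?_⟩⟩
  · refine WellTyped.rename hc (τ := τ) (.and h.typed (.le _ _ _ ?_)) fun x _ => hτρ x
    simp [h.head_type]
  · rw [hc.free_rename, hfree]
    rintro _ ⟨n, hn, rfl⟩ hn₂
    have hn0 : n = 0 := by
      by_contra h0
      exact absurd ((hρ2 n).2 h0) (not_le.2 hn₂)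
    subst hn0
    obtain ⟨T', hT', h0⟩ := h.head_mem 0 (hn.resolve_left (by norm_num)) (by norm_num)
    rcases hT' with rfl | rfl
    · exact absurd h0 (Set.notMem_empty _)
    · exact ⟨_, Or.inr rfl, h0, by simp [hρ0]⟩
  · rw [hc.scopes_rename, hsc]
    rintro _ ⟨s, hs, rfl⟩
    have h0 : ∀ n < 2, n ∈ ρ '' s ↔ n = 0 ∧ 0 ∈ s := by
      intro n hn
      constructor
      · rintro ⟨m, hm, rfl⟩
        have hm0 : m = 0 := by
          by_contra h0
          exact absurd ((hρ2 m).2 h0) (not_le.2 hn)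
        subst hm0
        exact ⟨rfl, hm⟩
      · rintro ⟨rfl, h⟩
        exact ⟨0, h, rfl⟩
    obtain ⟨T', hT', hs'⟩ := h.touch s hs
    rcases hT' with rfl | rfl
    · refine ⟨∅, Or.inl rfl, fun n hn => ?_⟩
      simp [h0 n hn, hs' 0]
    · refine ⟨_, Or.inr rfl, fun n hn => ?_⟩
      rw [h0 n hn, hs' 0 (by norm_num)]
      interval_cases n <;> simp
  · rw [hc.scopes_rename, hsc]
    have below : ∀ u v, u ≠ 0 → Below φ.scopes u v →
        2 ≤ ρ u ∧ Below ((ρ '' ·) '' φ.scopes) (ρ u) (ρ v) := by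
      rintro u v hu huv
      refine ⟨(hρ2 u).2 hu, ?_⟩
      rintro _ ⟨s, hs, rfl⟩ ⟨n, hn, hnu⟩
      obtain rfl := hinj n u hnu
      exact ⟨v, huv s hs hn, rfl⟩
    have one_zero : ∀ s ∈ φ.scopes, 1 ∈ s → 0 ∈ s → Below φ.scopes 1 0 := by
      intro s hs h1 h0 s' hs' h1'
      obtain ⟨T₁, hT₁, hs₁⟩ := h.touch s hs
      obtain ⟨T₂, hT₂, hs₂⟩ := h.touch s' hs'
      have e₁ := (hs₁ 1 (by norm_num)).1 h1
      have e₂ := (hs₂ 1 (by norm_num)).1 h1'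
      rcases hT₁ with rfl | rfl
      · exact absurd e₁ (Set.notMem_empty _)
      rcases hT₂ with rfl | rfl
      · exact absurd e₂ (Set.notMem_empty _)
      exact (hs₂ 0 (by norm_num)).2 ((hs₁ 0 (by norm_num)).1 h0)
    rintro _ ⟨s, hs, rfl⟩ _ ⟨u, hu, rfl⟩ _ ⟨v, hv, rfl⟩ huv
    have huv' : u ≠ v := fun h => huv (h ▸ rfl)
    rcases h.hier s hs u hu v hv huv' with ⟨h₁, h₂⟩ | ⟨h₁, h₂⟩ | ⟨h₁, h₂⟩
    · exact Or.inl (below u v (by omega) h₂)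
    · exact Or.inr (Or.inl (below v u (by omega) h₂))
    · interval_cases u <;> interval_cases v
      · exact absurd rfl huv'
      · exact Or.inr (Or.inl (below 1 0 (by norm_num) (one_zero s hs hv hu)))
      · exact Or.inl (below 1 0 (by norm_num) (one_zero s hs hu hv))
      · exact absurd rfl huv'
  · refine List.nodup_cons.2 ⟨?_, h.nodup.map fun n m => hinj n m⟩
    simp only [List.mem_map, not_exists, not_and]
    intro n hn h2
    exact h1Y (hinj n 1 h2 ▸ hn)
  · intro n
    rw [hc.free_rename, hfree]
    simp only [List.mem_cons, List.mem_map, h.mem]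
    constructor
    · rintro (rfl | ⟨m, ⟨hm, hm₂⟩, rfl⟩)
      · exact ⟨⟨1, Or.inl rfl, rfl⟩, le_rfl⟩
      · exact ⟨⟨m, Or.inr hm, rfl⟩, (hρ2 m).2 (by omega)⟩
    · rintro ⟨⟨m, hm, rfl⟩, hm₂⟩
      rcases hm with rfl | hm
      · exact Or.inl rfl
      · by_cases hm1 : m = 1
        · exact Or.inl (by rw [hm1, hρ1])
        · exact Or.inr ⟨m, ⟨hm, by have := (hρ2 m).1 hm₂; omega⟩, rfl⟩
  · intro I db hI ν
    simp only [sumOver]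
    have hτ2 : τ' 2 = t 1 := by rw [← hρ1, hτρ, h.head_type 1 (by norm_num)]
    rw [hτ2]
    refine Finset.sum_congr rfl fun d hd => ?_
    rw [show (φ'.rename ρ).eval db = fun μ => φ'.eval db (μ ∘ ρ) from
      funext fun μ => hc.eval_rename ρ db μ, sumOver_map _ fun y _ n hn => hinj n y hn,
      show ((fun x => I.dim (τ' x)) ∘ ρ) = fun x => I.dim (τ x) from
        funext fun n => by simp [hτρ]]
    have hle : φ'.eval db = fun μ => (if μ 1 ≤ db.const (E.const (t 1)) then 1 else 0) *
        φ.eval db μ := by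
      funext μ
      rw [mul_comm]
      rfl
    rw [hle, sumOver_mul_left _ fun y hy μ d => by
      have : (1 : ℕ) ≠ y := fun h => h1Y (h ▸ hy)
      simp [this], hI.2, ← h.value I db hI]
    simp [hρ, (Finset.mem_Icc.1 hd).2]

end Presentations

/-! ### Simple expressions as conjunctions -/

section Simple

variable {K : Type*} [CommSemiring K] {S : Schema} {V : Vocab} {E : SchemaEncoding S V}
  {a b : S.Size}

/-- The types of the head variables `0` and `1` for a matrix of type `(a, b)`. -/
def headTypes (a b : S.Size) : ℕ → S.Size := fun n => if n = 0 then a else b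

/-- The head variables for a matrix of type `(a, b)` that occur in atoms: a row or column variable
of type `1` is not used. -/
def slots (a b : S.Size) : Set ℕ := {n | (n = 0 ∧ a ≠ S.one) ∨ (n = 1 ∧ b ≠ S.one)}

open Classical in
/-- The index `p` for a row or column of type `a`, replaced by `1` for the type `1`. -/
noncomputable def clip (a : S.Size) (p : ℕ+) : ℕ+ := if a = S.one then 1 else p

theorem clip_one (p : ℕ+) : clip S.one p = 1 := if_pos rfl

theorem clip_of_ne (h : a ≠ S.one) (p : ℕ+) : clip a p = p := if_neg h

/-- The function `f` is defined by a conjunction whose atoms each mention all head variables of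
type other than `1` or none of the head variables. -/
def MatrixPresentable (E : SchemaEncoding S V) (a b : S.Size)
    (f : Instance K S → ℕ+ → ℕ+ → K) : Prop :=
  Presentable E (headTypes a b) {∅, slots a b} f

theorem zero_mem_slots : 0 ∈ slots a b ↔ a ≠ S.one := by simp [slots]

theorem one_mem_slots : 1 ∈ slots a b ↔ b ≠ S.one := by simp [slots]

theorem MatrixPresentable.mul {f₁ f₂ : Instance K S → ℕ+ → ℕ+ → K}
    (h₁ : MatrixPresentable E a b f₁) (h₂ : MatrixPresentable E a b f₂) :
    MatrixPresentable E a b fun I p q => f₁ I p q * f₂ I p q := by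
  have := Presentable.mul h₁ h₂
  rwa [Set.union_self] at this

theorem MatrixPresentable.scalar_mul {f₁ f₂ : Instance K S → ℕ+ → ℕ+ → K}
    (h₁ : MatrixPresentable E S.one S.one f₁) (h₂ : MatrixPresentable E a b f₂) :
    MatrixPresentable E a b fun I p q => f₁ I p q * f₂ I p q := by
  refine MatrixPresentable.mul (Presentable.congr h₁ (fun T hT => ⟨∅, Or.inl rfl, ?_⟩) ?_
    fun _ _ _ => rfl) h₂
  · rcases hT with rfl | rfl <;> simp [slots]
  · intro T hT n hn hnT
    rcases hT with rfl | rfl <;> simp [slots] at hnT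

theorem MatrixPresentable.swap {f : Instance K S → ℕ+ → ℕ+ → K}
    (h : MatrixPresentable E a b f) : MatrixPresentable E b a fun I p q => f I q p := by
  obtain ⟨φ, τ, Y, h⟩ := h
  set ρ : ℕ → ℕ := fun n => if n = 0 then 1 else if n = 1 then 0 else n with hρ
  have hρρ : ∀ n, ρ (ρ n) = n := by
    rintro (_ | _ | n) <;> simp [hρ]
  have hρ₂ : ∀ n, ρ n < 2 ↔ n < 2 := by
    intro n
    simp only [hρ]
    split_ifs <;> omega
  refine ⟨_, τ ∘ ρ, _, h.rename (ρ := ρ) (fun n m _ e => by rw [← hρρ n, e, hρρ]) hρ₂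
    (fun n hn => ?_) (fun n _ => congrArg τ (hρρ n)) (fun T hT => ?_) fun I ν => rfl⟩
  · rw [Function.comp_apply, h.head_type _ ((hρ₂ n).2 hn)]
    interval_cases n <;> rfl
  · rcases hT with rfl | rfl
    · exact ⟨∅, Or.inl rfl, by simp⟩
    · refine ⟨_, Or.inr rfl, fun n hn => ?_⟩
      constructor
      · intro h
        refine ⟨ρ n, (hρ₂ n).2 hn, ?_, hρρ n⟩
        interval_cases n
        · exact one_mem_slots.2 (zero_mem_slots.1 h)
        · exact zero_mem_slots.2 (one_mem_slots.1 h)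
      · rintro ⟨m, hm, h, rfl⟩
        interval_cases m
        · exact one_mem_slots.2 (zero_mem_slots.1 h)
        · exact zero_mem_slots.2 (one_mem_slots.1 h)

/-- The diagonal is obtained by identification of the two head variables. -/
theorem MatrixPresentable.diag {f : Instance K S → ℕ+ → ℕ+ → K} (ha : a ≠ S.one)
    (h : MatrixPresentable E a a f) :
    MatrixPresentable E a S.one fun I p _ => f I p p := by
  obtain ⟨φ, τ, Y, h⟩ := h
  set ρ : ℕ → ℕ := fun n => if n < 2 then 0 else n with hρ
  have h0 : ∀ n < 2, ρ n = 0 := fun n hn => if_pos hn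
  have h2 : ∀ n, 2 ≤ n → ρ n = n := fun n hn => if_neg (by omega)
  have hρ₂ : ∀ n, ρ n < 2 ↔ n < 2 := by
    intro n
    simp only [hρ]
    split_ifs <;> omega
  refine ⟨_, fun n => if n < 2 then headTypes a S.one n else τ n, _, h.rename (ρ := ρ)
    (fun n m hm e => ?_) hρ₂ (fun n hn => if_pos hn) (fun n _ => ?_) (fun T hT => ?_)
    fun I ν => rfl⟩
  · rw [h2 m hm] at e
    by_cases hn : n < 2
    · rw [h0 n hn] at e
      omega
    · rwa [h2 n (by omega)] at e
  · by_cases hn : n < 2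
    · rw [h0 n hn, h.head_type n hn]
      simp [headTypes]
    · rw [h2 n (by omega), if_neg hn]
  · rcases hT with rfl | rfl
    · exact ⟨∅, Or.inl rfl, by simp⟩
    · refine ⟨_, Or.inr rfl, fun n hn => ?_⟩
      constructor
      · rintro (⟨rfl, -⟩ | ⟨-, h⟩)
        · exact ⟨0, by norm_num, zero_mem_slots.2 ha, rfl⟩
        · exact absurd rfl h
      · rintro ⟨m, hm, -, rfl⟩
        rw [h0 m hm]
        exact zero_mem_slots.2 ha

theorem MatrixPresentable.sum {f : Instance K S → ℕ+ → ℕ+ → K} (hb : b ≠ S.one)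
    (h : MatrixPresentable E a b f) :
    MatrixPresentable E a S.one fun I p _ => ∑ d ∈ Finset.Icc 1 (I.dim b), f I p d := by
  refine Presentable.congr (Presentable.sum h (one_mem_slots.2 hb)) (fun T hT => ?_) ?_
    fun _ _ _ => rfl
  · rcases hT with rfl | rfl
    · exact ⟨∅, Or.inl rfl, fun _ _ => Iff.rfl⟩
    · refine ⟨_, Or.inr rfl, fun n hn => ?_⟩
      interval_cases n
      · simp [zero_mem_slots]
      · simp [one_mem_slots]
  · intro T hT n hn hnT
    rcases hT with rfl | rfl
    · exact absurd hnT (Set.notMem_empty _)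
    · obtain rfl : n = 0 := by
        by_contra h0
        exact hnT.2 (show n = 1 by omega)
      rfl

/-- A comparison atom for the ones vector. For the type `1` its variable is a bound one. -/
theorem MatrixPresentable.ones (E : SchemaEncoding S V) (a : S.Size) :
    MatrixPresentable E a S.one fun (I : Instance K S) p _ => val I (.ones a) (clip a p) 1 := by
  by_cases ha : a = S.one
  · subst ha
    refine ⟨.le 2 (E.const S.one), fun _ => S.one, [2], .le _ _, .le _ _ _ (by simp),
      fun n hn => by simp [headTypes], ?_, by simp [Formula.scopes_le],
      by simp [Formula.scopes_le, HierAbove], by simp, ?_, fun I db hI ν => ?_⟩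
    · rintro _ rfl h
      exact absurd h (by norm_num)
    · intro n
      simp only [List.mem_singleton, Formula.free, Set.mem_singleton_iff]
      omega
    · simp only [sumOver]
      rw [sum_Icc_dim_one, Formula.eval, clip_one, val_ones, if_pos one_le, if_pos]
      simp
  · refine ⟨.le 0 (E.const a), headTypes a S.one, [], .le _ _, .le _ _ _ (by simp [headTypes]),
      fun n hn => rfl, ?_, by simp [Formula.scopes_le], by simp [Formula.scopes_le, HierAbove],
      by simp, ?_, fun I db hI ν => ?_⟩
    · rintro _ rfl -
      exact ⟨_, Or.inr rfl, zero_mem_slots.2 ha⟩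
    · intro n
      simp only [List.not_mem_nil, Formula.free, Set.mem_singleton_iff, false_iff]
      omega
    · rw [val_ones, clip_of_ne ha]
      simp only [sumOver, Formula.eval, hI.2, Equiv.symm_apply_apply]

/-- A relational atom for a matrix symbol. Arguments of type `1` are a bound variable of that type,
which takes only the value `1`. -/
theorem MatrixPresentable.sym (E : SchemaEncoding S V) (A : S.Sym) :
    MatrixPresentable E (S.row A) (S.col A) fun (I : Instance K S) p q =>
      val I (.sym A) (clip (S.row A) p) (clip (S.col A) q) := by
  classical
  obtain ⟨R, rfl⟩ := E.rel.symm.surjective A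
  obtain ⟨r, c, h₁, h₂, h₃, h₄, h₅, h₆⟩ := InstanceEncodes.exists_places (K := K) E R
  set a := S.row (E.rel.symm R) with ha
  set b := S.col (E.rel.symm R) with hb
  set xs : Fin (V.arity R) → ℕ := fun i =>
    if r = some i then (if a = S.one then 2 else 0) else (if b = S.one then 2 else 1) with hxs
  set τ : ℕ → S.Size := fun n => if n < 2 then headTypes a b n else S.one with hτ
  have hr : ∀ i, r = some i → xs i = if a = S.one then 2 else 0 := fun i hi => if_pos hi
  have hc : ∀ i, c = some i → xs i = if b = S.one then 2 else 1 := fun i hi => if_neg fun h => by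
    have := h₂ (h.trans hi.symm)
    simp [this] at h
  have hcases : ∀ i, xs i = 0 ∨ xs i = 1 ∨ xs i = 2 := by
    intro i
    simp only [hxs]
    split_ifs <;> simp
  have hmem : ∀ n < 2, n ∈ Set.range xs ↔ n ∈ slots a b := by
    intro n hn
    constructor
    · rintro ⟨i, rfl⟩
      rcases h₁ i with h | h
      · rw [hr i h] at hn ⊢
        split_ifs at hn ⊢ with h'
        · omega
        · exact zero_mem_slots.2 h'
      · rw [hc i h] at hn ⊢
        split_ifs at hn ⊢ with h'
        · omega
        · exact one_mem_slots.2 h'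
    · rintro (⟨rfl, h⟩ | ⟨rfl, h⟩)
      · obtain ⟨i, hi⟩ := Option.ne_none_iff_exists'.1 fun h' => h (h₃ h')
        exact ⟨i, by rw [hr i hi, if_neg h]⟩
      · obtain ⟨i, hi⟩ := Option.ne_none_iff_exists'.1 fun h' => h (h₄ h')
        exact ⟨i, by rw [hc i hi, if_neg h]⟩
  have hclip : ∀ μ : ℕ → ℕ+, (2 ∈ Set.range xs → μ 2 = 1) →
      r.elim 1 (μ ∘ xs) = clip a (μ 0) ∧ c.elim 1 (μ ∘ xs) = clip b (μ 1) := by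
    intro μ hμ
    constructor
    · rcases r with _ | i
      · rw [h₃ rfl, clip_one]
        rfl
      · have := hr i rfl
        simp only [Option.elim, Function.comp_apply]
        split_ifs at this with h
        · rw [this, hμ ⟨i, this⟩, h, clip_one]
        · rw [this, clip_of_ne h]
    · rcases c with _ | i
      · rw [h₄ rfl, clip_one]
        rfl
      · have := hc i rfl
        simp only [Option.elim, Function.comp_apply]
        split_ifs at this with h
        · rw [this, hμ ⟨i, this⟩, h, clip_one]
        · rw [this, clip_of_ne h]
  refine ⟨.rel R xs, τ, if 2 ∈ Set.range xs then [2] else [], .rel _ _, .rel _ _ _ ((h₅ _).2 ?_),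
    fun n hn => if_pos hn, fun n hn hn₂ => ⟨_, Or.inr rfl, (hmem n hn₂).1 hn⟩, ?_, ?_,
    by split_ifs <;> simp, ?_, fun I db hI ν => ?_⟩
  · constructor
    · rcases r with _ | i
      · exact h₃ rfl
      · have := hr i rfl
        simp only [Option.elim, Function.comp_apply]
        split_ifs at this with h <;> rw [this]
        · simpa [hτ] using h
        · simp [hτ, headTypes]
    · rcases c with _ | i
      · exact h₄ rfl
      · have := hc i rfl
        simp only [Option.elim, Function.comp_apply]
        split_ifs at this with h <;> rw [this]
        · simpa [hτ] using h
        · simp [hτ, headTypes]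
  · rw [Formula.scopes_rel]
    rintro _ rfl
    exact ⟨_, Or.inr rfl, hmem⟩
  · rw [Formula.scopes_rel]
    rintro _ rfl u hu v hv -
    have below : ∀ u v, v ∈ Set.range xs → Below {Set.range xs} u v := by
      rintro u v hv _ rfl -
      exact hv
    by_cases hu₂ : 2 ≤ u
    · exact Or.inl ⟨hu₂, below u v hv⟩
    · by_cases hv₂ : 2 ≤ v
      · exact Or.inr (Or.inl ⟨hv₂, below v u hu⟩)
      · exact Or.inr (Or.inr ⟨not_le.1 hu₂, not_le.1 hv₂⟩)
  · intro n
    change _ ↔ n ∈ Set.range xs ∧ 2 ≤ n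
    constructor
    · intro hn
      split_ifs at hn with h
      · obtain rfl := List.mem_singleton.1 hn
        exact ⟨h, le_rfl⟩
      · simp at hn
    · rintro ⟨⟨i, rfl⟩, hn⟩
      have h2 : xs i = 2 := by
        rcases hcases i with h | h | h <;> omega
      rw [if_pos ⟨i, h2⟩, h2]
      exact List.mem_singleton.2 rfl
  · split_ifs with h
    · simp only [sumOver]
      rw [show τ 2 = S.one from if_neg (by norm_num), sum_Icc_dim_one, Formula.eval, h₆ I db hI,
        (hclip _ fun _ => by simp).1, (hclip _ fun _ => by simp).2,
        Function.update_of_ne (by norm_num), Function.update_of_ne (by norm_num)]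
    · simp only [sumOver]
      rw [Formula.eval, h₆ I db hI, (hclip ν fun h' => absurd h' h).1,
        (hclip ν fun h' => absurd h' h).2]

/-- The value of `e` is a matrix that a conjunction defines, or a diagonal matrix whose diagonal is
a vector that a conjunction defines. In the second case the type is not `(1, 1)`. -/
def ExprPresentable (K : Type*) [CommSemiring K] (E : SchemaEncoding S V) {a b : S.Size}
    (e : Expr S a b) : Prop :=
  MatrixPresentable E a b (fun (I : Instance K S) p q => val I e (clip a p) (clip b q)) ∨
    a ≠ S.one ∧ a = b ∧ ∃ g : Instance K S → ℕ+ → K,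
      MatrixPresentable E a S.one (fun I p _ => g I p) ∧
        ∀ I p q, val I e p q = if p = q then g I p else 0

theorem ExprPresentable.of_row_one {e : Expr S S.one b} (h : ExprPresentable K E e) :
    MatrixPresentable E S.one b
      fun (I : Instance K S) p q => val I e (clip S.one p) (clip b q) :=
  h.resolve_right fun h => h.1 rfl

theorem ExprPresentable.of_col_one {e : Expr S a S.one} (h : ExprPresentable K E e) :
    MatrixPresentable E a S.one
      fun (I : Instance K S) p q => val I e (clip a p) (clip S.one q) :=
  h.resolve_right fun h => h.1 h.2.1

theorem IsSimple.presentable (K : Type*) [CommSemiring K] (E : SchemaEncoding S V) {a b : S.Size}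
    {e : Expr S a b} (h : IsSimple e) : ExprPresentable K E e := by
  induction h with
  | sym A => exact Or.inl (MatrixPresentable.sym E A)
  | ones a =>
    refine Or.inl ?_
    simp only [clip_one]
    exact MatrixPresentable.ones E a
  | ident a =>
    by_cases ha : a = S.one
    · subst ha
      refine Or.inl ?_
      have := MatrixPresentable.ones (K := K) E S.one
      simpa only [clip_one, val_ones, val_ident, if_true] using this
    · refine Or.inr ⟨ha, rfl, fun I p => val I (.ones a) p 1, ?_, fun I p q => ?_⟩
      · simpa only [clip_of_ne ha] using MatrixPresentable.ones (K := K) E a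
      · simp only [val_ident, val_ones]
  | @transpose a b e _ ih =>
    rcases ih with ih | ⟨ha, rfl, g, hg, hv⟩
    · refine Or.inl ?_
      simp only [val_transpose]
      exact ih.swap
    · refine Or.inr ⟨ha, rfl, g, hg, fun I p q => ?_⟩
      rw [val_transpose, hv]
      by_cases hpq : p = q
      · simp [hpq]
      · simp [hpq, Ne.symm hpq]
  | @smul a b e₁ e₂ _ _ ih₁ ih₂ =>
    have h₁ := ih₁.of_row_one
    simp only [clip_one] at h₁
    rcases ih₂ with ih₂ | ⟨ha, hab, g, hg, hv⟩
    · refine Or.inl ?_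
      simp only [val_smul]
      exact h₁.scalar_mul ih₂
    · refine Or.inr ⟨ha, hab, fun I p => val I e₁ 1 1 * g I p, h₁.scalar_mul hg, fun I p q => ?_⟩
      rw [val_smul, hv, mul_ite, mul_zero]
  | @had a b e₁ e₂ _ _ ih₁ ih₂ =>
    rcases ih₁ with ih₁ | ⟨ha, rfl, g₁, hg₁, hv₁⟩
    · rcases ih₂ with ih₂ | ⟨ha, rfl, g₂, hg₂, hv₂⟩
      · refine Or.inl ?_
        simp only [val_had]
        exact ih₁.mul ih₂
      · simp only [clip_of_ne ha] at ih₁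
        refine Or.inr ⟨ha, rfl, fun I p => val I e₁ p p * g₂ I p,
          (ih₁.diag ha).mul hg₂, fun I p q => ?_⟩
        rw [val_had, hv₂]
        by_cases hpq : p = q
        · simp [hpq]
        · simp [hpq]
    · rcases ih₂ with ih₂ | ⟨-, -, g₂, hg₂, hv₂⟩
      · simp only [clip_of_ne ha] at ih₂
        refine Or.inr ⟨ha, rfl, fun I p => g₁ I p * val I e₂ p p,
          hg₁.mul (ih₂.diag ha), fun I p q => ?_⟩
        rw [val_had, hv₁]
        by_cases hpq : p = q
        · simp [hpq]
        · simp [hpq]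
      · refine Or.inr ⟨ha, rfl, fun I p => g₁ I p * g₂ I p, hg₁.mul hg₂, fun I p q => ?_⟩
        rw [val_had, hv₁, hv₂]
        by_cases hpq : p = q
        · simp [hpq]
        · simp [hpq]
  | @mulOnes a b e _ ih =>
    refine Or.inl ?_
    simp only [clip_one, val_mul_ones]
    rcases ih with ih | ⟨ha, rfl, g, hg, hv⟩
    · by_cases hb : b = S.one
      · subst hb
        simp only [clip_one] at ih
        simpa only [sum_Icc_dim_one] using ih
      · simpa only [clip_of_ne hb] using ih.sum hb
    · have : ∀ (I : Instance K S) p, ∑ z ∈ Finset.Icc 1 (I.dim a), val I e p z = g I p := by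
        intro I p
        simp only [hv]
        rw [Finset.sum_ite_eq]
        split_ifs with h
        · rfl
        · have := hv I p p
          rw [if_pos rfl] at this
          rw [← this]
          exact (val_eq_zero_of_row I (fun h' => h (Finset.mem_Icc.2 ⟨one_le, h'⟩)) _ _).symm
      simpa only [clip_of_ne ha, this] using hg

end Simple

/-! ### From qh-MATLANG to conjunctive queries -/

section ToQuery

variable {K : Type*} [CommSemiring K] {S : Schema} {V : Vocab} {E : SchemaEncoding S V}
  {a b : S.Size}

/-- The conjunction of `φ` with the atoms `n ≤ c` for `n` in `L`, where `c` is the constant for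
the type of `n`. -/
def Formula.bounded (E : SchemaEncoding S V) (t : ℕ → S.Size) (φ : Formula V) :
    List ℕ → Formula V
  | [] => φ
  | n :: L => (Formula.bounded E t φ L).and (.le n (E.const (t n)))

theorem Formula.IsConj.bounded {φ : Formula V} (h : φ.IsConj) (t : ℕ → S.Size) (L : List ℕ) :
    (φ.bounded E t L).IsConj := by
  induction L with
  | nil => exact h
  | cons n L ih => exact .and ih (.le _ _)

theorem WellTyped.bounded {φ : Formula V} {t : ℕ → S.Size} (h : WellTyped E φ t) (L : List ℕ) :
    WellTyped E (φ.bounded E t L) t := by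
  induction L with
  | nil => exact h
  | cons n L ih => exact .and ih (.le _ _ _ (by simp))

theorem Formula.scopes_bounded (φ : Formula V) (t : ℕ → S.Size) (L : List ℕ) :
    (φ.bounded E t L).scopes = φ.scopes := by
  induction L with
  | nil => rfl
  | cons n L ih => rw [Formula.bounded, Formula.scopes_and, Formula.scopes_le, ih, Set.union_empty]

theorem Formula.mem_free_bounded (φ : Formula V) (t : ℕ → S.Size) (L : List ℕ) (n : ℕ) :
    n ∈ (φ.bounded E t L).free ↔ n ∈ φ.free ∨ n ∈ L := by
  induction L with
  | nil => simp [Formula.bounded]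
  | cons m L ih =>
    simp only [Formula.bounded, Formula.free, Set.mem_union, ih, Set.mem_singleton_iff,
      List.mem_cons]
    tauto

open Classical in
theorem Formula.eval_bounded {I : Instance K S} {db : Database K V}
    (hI : InstanceEncodes E I db) (φ : Formula V) (t : ℕ → S.Size) (L : List ℕ) (ν : ℕ → ℕ+) :
    (φ.bounded E t L).eval db ν =
      (if ∀ n ∈ L, ν n ≤ I.dim (t n) then 1 else 0) * φ.eval db ν := by
  induction L with
  | nil => simp [Formula.bounded]
  | cons n L ih =>
    rw [Formula.bounded, Formula.eval, ih, Formula.eval, hI.2, Equiv.symm_apply_apply]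
    simp only [List.forall_mem_cons]
    by_cases h : ν n ≤ I.dim (t n) <;> simp [h]

open Classical in
/-- A presentable function gives a binary q-hierarchical query, for every head over the variables
`0` and `1` that lists all used head variables, if `0` and `1` are comparable. -/
theorem Presentable.exists_query {t : ℕ → S.Size} {𝒯 : Set (Set ℕ)}
    {f : Instance K S → ℕ+ → ℕ+ → K} (h : Presentable E t 𝒯 f)
    (h𝒯 : (∀ T ∈ 𝒯, 0 ∈ T → 1 ∈ T) ∨ (∀ T ∈ 𝒯, 1 ∈ T → 0 ∈ T) ∨ ∀ T ∈ 𝒯, 0 ∈ T → 1 ∉ T)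
    {k : ℕ} (hk : k ≤ 2) (head : Fin k → ℕ) (hhead : ∀ i, head i < 2)
    (hcover : ∀ T ∈ 𝒯, ∀ n < 2, n ∈ T → n ∈ Set.range head)
    (hargs : ArgsTyped S a b (t ∘ head)) :
    ∃ Q : Query V k, Q.IsBinaryQHCQ ∧ Q.IsWellTyped E a b ∧
      ∀ (I : Instance K S) (db : Database K V), InstanceEncodes E I db → ∀ d : Fin k → ℕ+,
        ((∀ i j, head i = head j → d i = d j) → ∃ ν : ℕ → ℕ+, ν ∘ head = d ∧
          (∀ n ∉ Set.range head, ν n = 1) ∧ Q.output db d =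
            (if ∀ i, d i ≤ I.dim (t (head i)) then 1 else 0) * f I (ν 0) (ν 1)) ∧
        ((∃ i j, head i = head j ∧ d i ≠ d j) → Q.output db d = 0) := by
  obtain ⟨φ, τ, Y, h⟩ := h
  set ψ := φ.bounded E τ (List.ofFn head) with hψ
  have hconj : ψ.IsConj := h.conj.bounded _ _
  have htyped : WellTyped E ψ τ := h.typed.bounded _
  have hscopes : ψ.scopes = φ.scopes := Formula.scopes_bounded _ _ _
  have hfree : ∀ n, n ∈ ψ.free ↔ n ∈ φ.free ∨ n ∈ Set.range head := by
    intro n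
    rw [hψ, Formula.mem_free_bounded, List.mem_ofFn']
  have hY : ∀ y ∈ Y, 2 ≤ y ∧ y ∈ ψ.free := fun y hy =>
    ⟨((h.mem y).1 hy).2, (hfree y).2 (Or.inl ((h.mem y).1 hy).1)⟩
  have hhead_free : Set.range head = (Formula.exs Y ψ).free := by
    rw [Formula.free_exs]
    ext n
    simp only [Set.mem_sdiff, hfree, Set.mem_ofPred_eq, h.mem]
    constructor
    · rintro ⟨i, rfl⟩
      exact ⟨Or.inr ⟨i, rfl⟩, fun h => absurd h.2 (not_le.2 (hhead i))⟩
    · rintro ⟨hn | hn, hn'⟩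
      · have hn₂ : n < 2 := not_le.1 fun h => hn' ⟨hn, h⟩
        obtain ⟨T, hT, hnT⟩ := h.head_mem n hn hn₂
        exact hcover T hT n hn₂ hnT
      · exact hn
  have hheadt : τ ∘ head = t ∘ head := funext fun i => h.head_type _ (hhead i)
  refine ⟨⟨head, Formula.exs Y ψ, hhead_free⟩, ⟨hconj.isPrenex_exs Y, ⟨hk, fun x _ =>
    (E.fits x.1).1⟩, ?_⟩, ⟨τ, htyped.exs Y, hheadt ▸ hargs⟩, fun I db hI d => ⟨fun hd => ?_, ?_⟩⟩
  · rw [isQHierarchical_iff]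
    have hs : (Formula.exs Y ψ).scopes = φ.scopes := by
      rw [← hscopes, Formula.scopes, Formula.relAtoms_exs]
      rfl
    have hB : ∀ s ∈ φ.scopes, ∀ u ∈ s, u < 2 → u ∈ Set.range head := by
      intro s hs u hu hu₂
      obtain ⟨T, hT, hsT⟩ := h.touch s hs
      exact hcover T hT u hu₂ ((hsT u hu₂).1 hu)
    have hB' : ∀ u, 2 ≤ u → u ∉ Set.range head := by
      rintro _ hu ⟨i, rfl⟩
      exact absurd (hhead i) (not_lt.2 hu)
    -- Two head variables in a common atom are comparable by the condition on `𝒯`.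
    have heads : ∀ s ∈ φ.scopes, 0 ∈ s → 1 ∈ s → Below φ.scopes 0 1 ∨ Below φ.scopes 1 0 := by
      intro s hs h0 h1
      rcases h𝒯 with h𝒯 | h𝒯 | h𝒯
      · refine Or.inl fun s' hs' hs0 => ?_
        obtain ⟨T, hT, hsT⟩ := h.touch s' hs'
        exact (hsT 1 (by norm_num)).2 (h𝒯 T hT ((hsT 0 (by norm_num)).1 hs0))
      · refine Or.inr fun s' hs' hs1 => ?_
        obtain ⟨T, hT, hsT⟩ := h.touch s' hs'
        exact (hsT 0 (by norm_num)).2 (h𝒯 T hT ((hsT 1 (by norm_num)).1 hs1))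
      · obtain ⟨T, hT, hsT⟩ := h.touch s hs
        exact absurd ((hsT 1 (by norm_num)).1 h1) (h𝒯 T hT ((hsT 0 (by norm_num)).1 h0))
    simp only [hs]
    rintro s hs u hu v hv huv
    rcases h.hier s hs u hu v hv huv with ⟨h₁, h₂⟩ | ⟨h₁, h₂⟩ | ⟨h₁, h₂⟩
    · exact Or.inl ⟨fun _ => hB' u h₁, h₂⟩
    · exact Or.inr ⟨fun _ => hB' v h₁, h₂⟩
    · have hu' : ¬ u ∈ {x | x ∉ Set.range head} := fun h => h (hB s hs u hu h₁)
      have hv' : ¬ v ∈ {x | x ∉ Set.range head} := fun h => h (hB s hs v hv h₂)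
      have : Below φ.scopes u v ∨ Below φ.scopes v u := by
        interval_cases u <;> interval_cases v
        · exact absurd rfl huv
        · exact heads s hs hu hv
        · exact (heads s hs hv hu).symm
        · exact absurd rfl huv
      exact this.imp (fun h => ⟨fun h' => absurd h' hv', h⟩) fun h => ⟨fun h' => absurd h' hu', h⟩
  · have hext : (Function.extend head d fun _ => 1) ∘ head = d := by
      funext i
      exact Function.FactorsThrough.extend_apply (fun i j h => hd i j h) (fun _ => 1) i
    refine ⟨_, hext, fun n hn => Function.extend_apply' _ _ _ hn, ?_⟩
    rw [Query.output, if_pos hd]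
    change (Formula.exs Y ψ).eval db _ = _
    rw [eval_exs hI hconj htyped h.nodup fun y hy => (hY y hy).2]
    set ν := Function.extend head d fun _ => 1
    rw [show ψ.eval db = fun μ => _ from funext fun μ => Formula.eval_bounded hI φ τ _ μ,
      sumOver_mul_left _ fun y hy μ d => ?_, h.value I db hI]
    · congr 1
      refine if_congr ?_ rfl rfl
      simp only [List.forall_mem_ofFn_iff]
      refine forall_congr' fun i => ?_
      rw [show ν (head i) = d i from congrFun hext i, show τ (head i) = t (head i) from
        congrFun hheadt i]
    · refine if_congr ?_ rfl rfl
      simp only [List.forall_mem_ofFn_iff]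
      refine forall_congr' fun i => ?_
      rw [Function.update_of_ne]
      have := hhead i
      have := (hY y hy).1
      omega
  · rintro ⟨i, j, hij, hne⟩
    rw [Query.output, if_neg]
    exact fun h => hne (h i j hij)

/-- A function that is presented by a conjunction and has the values of `e` inside the matrix
gives a query that simulates `e`. -/
theorem exists_query_of_presentable {e : Expr S a b} {𝒯 : Set (Set ℕ)}
    {f : Instance K S → ℕ+ → ℕ+ → K} (h : Presentable E (headTypes a b) 𝒯 f)
    (h𝒯 : (∀ T ∈ 𝒯, 0 ∈ T → 1 ∈ T) ∨ (∀ T ∈ 𝒯, 1 ∈ T → 0 ∈ T) ∨ ∀ T ∈ 𝒯, 0 ∈ T → 1 ∉ T)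
    (hslots : ∀ T ∈ 𝒯, T ⊆ slots a b)
    (hf : ∀ (I : Instance K S) p q, p ≤ I.dim a → q ≤ I.dim b →
      f I p q = val I e (clip a p) (clip b q))
    {k : ℕ} (hk : ArityFits S a b k) :
    ∃ Q : Query V k, Q.IsBinaryQHCQ ∧ Q.IsWellTyped E a b ∧ Simulates K E e Q := by
  classical
  obtain ⟨r, c, h₁, h₂, h₃, h₄, h₅, h₆⟩ := hk.exists_places K
  set head : Fin k → ℕ := fun i => if r = some i then 0 else 1 with hhead
  have hr : ∀ i, r = some i → head i = 0 := fun i hi => if_pos hi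
  have hc : ∀ i, c = some i → head i = 1 := fun i hi => if_neg fun h => by
    have := h₂ (h.trans hi.symm)
    simp [this] at h
  have hinj : ∀ i j, head i = head j → i = j := by
    intro i j hij
    rcases h₁ i with hi | hi <;> rcases h₁ j with hj | hj
    · exact Option.some_injective _ (hi.symm.trans hj)
    · rw [hr i hi, hc j hj] at hij
      omega
    · rw [hc i hi, hr j hj] at hij
      omega
    · exact Option.some_injective _ (hi.symm.trans hj)
  obtain ⟨Q, hQ, hQt, hv⟩ := h.exists_query (a := a) (b := b) h𝒯 hk.1 head
    (fun i => by simp only [hhead]; split_ifs <;> norm_num)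
    (fun T hT n hn hnT => by
      rcases hslots T hT hnT with ⟨rfl, hne⟩ | ⟨rfl, hne⟩
      · obtain ⟨i, hi⟩ := Option.ne_none_iff_exists'.1 fun h' => hne (h₃ h')
        exact ⟨i, hr i hi⟩
      · obtain ⟨i, hi⟩ := Option.ne_none_iff_exists'.1 fun h' => hne (h₄ h')
        exact ⟨i, hc i hi⟩)
    ((h₅ _).2 ⟨by
      rcases r with _ | i
      · exact h₃ rfl
      · simp [headTypes, hr i rfl], by
      rcases c with _ | i
      · exact h₄ rfl
      · simp [headTypes, hc i rfl]⟩)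
  refine ⟨Q, hQ, hQt, fun I db hI => (h₆ I _ _).2 fun d => ?_⟩
  change _ = val I e _ _
  obtain ⟨ν, hν, hν', ho⟩ := (hv I db hI d).1 fun i j hij => by rw [hinj i j hij]
  rw [ho]
  have hν0 : ν 0 = r.elim 1 d := by
    rcases r with _ | i
    · refine hν' 0 ?_
      rintro ⟨i, hi⟩
      exact absurd hi (by simp [hhead])
    · rw [← hν, Option.elim, Function.comp_apply, hr i rfl]
  have hν1 : ν 1 = c.elim 1 d := by
    rcases c with _ | i
    · refine hν' 1 ?_
      rintro ⟨i, hi⟩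
      rw [hr i ((h₁ i).resolve_right (by simp))] at hi
      exact absurd hi (by norm_num)
    · rw [← hν, Option.elim, Function.comp_apply, hc i rfl]
  have ht0 : ∀ i, r = some i → headTypes a b (head i) = a := fun i hi => by
    rw [hr i hi]
    rfl
  have ht1 : ∀ i, c = some i → headTypes a b (head i) = b := fun i hi => by
    rw [hc i hi]
    rfl
  -- In range, a variable for a row or column of type `1` has the value `1`.
  have hclip : ∀ (s : S.Size) (p : ℕ+), p ≤ I.dim s → clip s p = p := by
    intro s p hp
    by_cases hs : s = S.one
    · subst hs
      rw [I.dim_one] at hp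
      rw [clip_one, le_antisymm hp one_le]
    · exact clip_of_ne hs p
  split_ifs with hd
  · rw [one_mul]
    have h0 : ν 0 ≤ I.dim a := by
      rw [hν0]
      rcases r with _ | i
      · exact one_le
      · exact ht0 i rfl ▸ hd i
    have h1 : ν 1 ≤ I.dim b := by
      rw [hν1]
      rcases c with _ | i
      · exact one_le
      · exact ht1 i rfl ▸ hd i
    rw [hf I _ _ h0 h1, hclip a _ h0, hclip b _ h1, hν0, hν1]
  · rw [zero_mul]
    obtain ⟨i, hi⟩ := not_forall.1 hd
    rcases h₁ i with hi' | hi'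
    · rw [ht0 i hi'] at hi
      rw [hi']
      exact (val_eq_zero_of_row I hi _ _).symm
    · rw [ht1 i hi'] at hi
      rw [hi']
      exact (val_eq_zero_of_col I hi _ _).symm

/-- The query for a diagonal matrix repeats its head variable. -/
theorem exists_query_of_diag {e : Expr S a a} (ha : a ≠ S.one) {g : Instance K S → ℕ+ → K}
    (h : MatrixPresentable E a S.one fun I p _ => g I p)
    (hv : ∀ I p q, val I e p q = if p = q then g I p else 0)
    {k : ℕ} (hk : ArityFits S a a k) :
    ∃ Q : Query V k, Q.IsBinaryQHCQ ∧ Q.IsWellTyped E a a ∧ Simulates K E e Q := by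
  classical
  obtain ⟨r, c, h₁, -, h₃, h₄, h₅, h₆⟩ := hk.exists_places K
  obtain ⟨i, rfl⟩ := Option.ne_none_iff_exists'.1 fun h' => ha (h₃ h')
  obtain ⟨j, rfl⟩ := Option.ne_none_iff_exists'.1 fun h' => ha (h₄ h')
  obtain ⟨Q, hQ, hQt, ho⟩ := Presentable.exists_query (a := a) (b := a) h
    (Or.inr (Or.inl fun T hT h1 => by
      rcases hT with rfl | rfl
      · exact absurd h1 (Set.notMem_empty _)
      · exact absurd rfl (one_mem_slots.1 h1)))
    hk.1 (fun _ => 0) (fun _ => by norm_num)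
    (fun T hT n hn hnT => by
      rcases hT with rfl | rfl
      · exact absurd hnT (Set.notMem_empty _)
      · rcases hnT with ⟨rfl, -⟩ | ⟨-, h'⟩
        · exact ⟨i, rfl⟩
        · exact absurd rfl h')
    ((h₅ _).2 ⟨rfl, rfl⟩)
  refine ⟨Q, hQ, hQt, fun I db hI => (h₆ I _ _).2 fun d => ?_⟩
  change _ = val I e (d i) (d j)
  by_cases hd : d i = d j
  · have hall : ∀ l, d l = d i := fun l => by
      rcases h₁ l with hl | hl
      · rw [Option.some_injective _ hl]
      · rw [← Option.some_injective _ hl, hd]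
    obtain ⟨ν, hν, -, ho⟩ := (ho I db hI d).1 fun l l' _ => by rw [hall l, hall l']
    have hν0 : ν 0 = d i := by rw [← hν, Function.comp_apply]
    rw [ho, hν0, hv, if_pos hd]
    split_ifs with hle
    · exact one_mul _
    · obtain ⟨l, hl⟩ := not_forall.1 hle
      rw [hall l] at hl
      have : val I e (d i) (d i) = 0 := val_eq_zero_of_row I hl e (d i)
      rw [hv, if_pos rfl] at this
      rw [this, mul_zero]
  · rw [(ho I db hI d).2 ⟨i, j, rfl, hd⟩, hv, if_neg hd]

theorem mem_family_iff {P : Set ℕ → Prop} {T₁ T₂ : Set ℕ} (h : P ∅) :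
    (∀ T ∈ ({∅, T₁} ∪ {∅, T₂} : Set (Set ℕ)), P T) ↔ P T₁ ∧ P T₂ := by
  simp only [Set.mem_union, Set.mem_insert_iff, Set.mem_singleton_iff]
  constructor
  · exact fun H => ⟨H _ (by simp), H _ (by simp)⟩
  · rintro ⟨h₁, h₂⟩ T ((rfl | rfl) | (rfl | rfl)) <;> assumption

/-- If one of the two factors is a vector or scalar, then at most one of them has atoms that mention
both head variables, and the atoms of the other mention at most one. So the head variables are
comparable in the product. -/
theorem exists_query_of_mul {e : Expr S a b} {a₁ b₁ a₂ b₂ : S.Size}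
    {f₁ f₂ : Instance K S → ℕ+ → ℕ+ → K} (h₁ : MatrixPresentable E a₁ b₁ f₁)
    (h₂ : MatrixPresentable E a₂ b₂ f₂)
    (ha₁ : a₁ ≠ S.one → a₁ = a) (hb₁ : b₁ ≠ S.one → b₁ = b)
    (ha₂ : a₂ ≠ S.one → a₂ = a) (hb₂ : b₂ ≠ S.one → b₂ = b)
    (hone : a₁ = S.one ∨ b₁ = S.one ∨ a₂ = S.one ∨ b₂ = S.one)
    (hf : ∀ (I : Instance K S) p q, p ≤ I.dim a → q ≤ I.dim b →
      f₁ I p q * f₂ I p q = val I e (clip a p) (clip b q))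
    {k : ℕ} (hk : ArityFits S a b k) :
    ∃ Q : Query V k, Q.IsBinaryQHCQ ∧ Q.IsWellTyped E a b ∧ Simulates K E e Q := by
  have retype : ∀ {a' b' : S.Size} {f : Instance K S → ℕ+ → ℕ+ → K}, (a' ≠ S.one → a' = a) →
      (b' ≠ S.one → b' = b) → MatrixPresentable E a' b' f →
        Presentable E (headTypes a b) {∅, slots a' b'} f := by
    intro a' b' f ha hb h
    refine Presentable.congr h (fun T hT => ⟨T, hT, fun _ _ => Iff.rfl⟩) (fun T hT n _ hnT => ?_)
      fun _ _ _ => rfl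
    rcases hT with rfl | rfl
    · exact absurd hnT (Set.notMem_empty _)
    · rcases hnT with ⟨rfl, h⟩ | ⟨rfl, h⟩
      · simpa [headTypes] using ha h
      · simpa [headTypes] using hb h
  have sub : ∀ {a' b' : S.Size}, (a' ≠ S.one → a' = a) → (b' ≠ S.one → b' = b) →
      slots a' b' ⊆ slots a b := by
    rintro a' b' ha hb n (⟨rfl, h⟩ | ⟨rfl, h⟩)
    · exact Or.inl ⟨rfl, ha h ▸ h⟩
    · exact Or.inr ⟨rfl, hb h ▸ h⟩
  refine exists_query_of_presentable ((retype ha₁ hb₁ h₁).mul (retype ha₂ hb₂ h₂)) ?_ ?_ hf hk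
  · rw [mem_family_iff (by simp), mem_family_iff (by simp), mem_family_iff (by simp)]
    simp only [zero_mem_slots, one_mem_slots, ne_eq]
    clear * - hone
    generalize (a₁ = S.one) = A₁, (b₁ = S.one) = B₁, (a₂ = S.one) = A₂, (b₂ = S.one) = B₂ at *
    tauto
  · rw [mem_family_iff (by simp)]
    exact ⟨sub ha₁ hb₁, sub ha₂ hb₂⟩

theorem clip_le {p m : ℕ+} (h : p ≤ m) : clip a p ≤ m := by
  unfold clip
  split_ifs
  · exact one_le
  · exact h

theorem IsQH.exists_query {e : Expr S a b} (he : IsQH e) (E : SchemaEncoding S V) {k : ℕ}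
    (hk : ArityFits S a b k) :
    ∃ Q : Query V k, Q.IsBinaryQHCQ ∧ Q.IsWellTyped E a b ∧ Simulates K E e Q := by
  cases he with
  | simple h =>
    rcases h.presentable K E with h | ⟨ha, rfl, g, hg, hv⟩
    · refine exists_query_of_presentable h ?_ ?_ (fun _ _ _ _ _ => rfl) hk
      · simp only [Set.forall_mem_insert, Set.mem_singleton_iff, forall_eq, Set.mem_empty_iff_false,
          zero_mem_slots, one_mem_slots]
        tauto
      · rintro T (rfl | rfl)
        · exact Set.empty_subset _
        · exact Set.Subset.rfl
    · exact exists_query_of_diag ha hg hv hk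
  | @hadCol e₁ e₂ h₁ h₂ =>
    have p₂ := (h₂.presentable K E).of_col_one
    simp only [clip_one] at p₂
    rcases h₁.presentable K E with p₁ | ⟨ha, rfl, g, hg, hv⟩
    · refine exists_query_of_mul p₁ p₂ (fun _ => rfl) (fun _ => rfl) (fun _ => rfl)
        (fun h => absurd rfl h) (by simp) (fun I p q _ hq => ?_) hk
      rw [val_had, val_mul_transpose_ones I _ _ (clip_le hq)]
    · simp only [clip_of_ne ha] at p₂
      refine exists_query_of_diag ha (g := fun I p => g I p * val I e₂ p 1) (hg.mul p₂)
        (fun I p q => ?_) hk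
      by_cases hq : q ≤ I.dim a
      · rw [val_had, val_mul_transpose_ones I _ _ hq, hv, ite_mul, zero_mul]
      · rw [val_eq_zero_of_col I hq]
        split_ifs with hpq
        · rw [hpq, val_eq_zero_of_row I hq, mul_zero]
        · rfl
  | @rowHad e₁ e₂ h₁ h₂ =>
    have p₁ := (h₁.presentable K E).of_row_one
    simp only [clip_one] at p₁
    rcases h₂.presentable K E with p₂ | ⟨ha, rfl, g, hg, hv⟩
    · refine exists_query_of_mul p₁ p₂ (fun h => absurd rfl h) (fun _ => rfl) (fun _ => rfl)
        (fun _ => rfl) (by simp) (fun I p q hp _ => ?_) hk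
      rw [val_had, val_ones_mul I _ _ (clip_le hp)]
    · simp only [clip_of_ne ha] at p₁
      refine exists_query_of_diag ha (g := fun I p => val I e₁ 1 p * g I p) (p₁.swap.mul hg)
        (fun I p q => ?_) hk
      by_cases hp : p ≤ I.dim a
      · rw [val_had, val_ones_mul I _ _ hp, hv, mul_ite, mul_zero]
        by_cases hpq : p = q
        · simp [hpq]
        · simp [hpq]
      · rw [val_eq_zero_of_row I hp, val_eq_zero_of_col I hp, zero_mul, ite_self]
  | @rowHadCol e₁ e₂ h₁ h₂ =>
    have p₁ := (h₁.presentable K E).of_row_one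
    have p₂ := (h₂.presentable K E).of_col_one
    simp only [clip_one] at p₁ p₂
    refine exists_query_of_mul p₁ p₂ (fun h => absurd rfl h) (fun _ => rfl) (fun _ => rfl)
      (fun h => absurd rfl h) (by simp) (fun I p q hp hq => ?_) hk
    rw [val_had, val_mul_transpose_ones I _ _ (clip_le hq), val_ones_mul I _ _ (clip_le hp)]

end ToQuery

end QHMatlang

theorem mainTheorem6 (K : Type*) [CommSemiring K] [Nontrivial K] :
    QHMatlang.EquallyExpressive K
      (fun {_ _ _} e => QHMatlang.IsQH e) (fun {_ _} Q => Q.IsBinaryQHCQ) :=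
  ⟨fun _ _ _ _ he _ E _ hk => he.exists_query E hk,
    fun _ _ _ hQ _ _ _ _ hk ht => QHMatlang.exists_qh_of_query hQ hk ht⟩
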